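/- Let $L>0$ and $s>\tfrac52$, let $\mathbb T^3=[-L,L)^3$ with periodic boundary conditions, and let $\|f\|_{H^\sigma}=\|(1-\Delta)^{\sigma/2}f\|_{L^2(\mathbb T^3)}$. There is a constant $C>0$, depending only on $L$ and $s$, with the following property. Let $\bar T>0$, let $\bar u_0\in H^{s+2}(\mathbb T^3)$, and let $\bar u\in L^\infty([0,\bar T];H^{s+2}(\mathbb T^3))$ be a solution on $[0,\bar T]$ of the incompressible Euler equations $$\partial_t\bar u+\bar u\cdot\nabla\bar u+\nabla\bar p=0,\qquad \nabla\cdot\bar u=0,\qquad \bar u(0)=\bar u_0 .$$ Let $\tilde u_0\in H^{s+1}(\mathbb T^3)$ and let $\varepsilon>0$ satisfy $$\varepsilon\, C\,\|\tilde u_0\|_{H^{s+1}}\,\bar T\;\le\;\exp\Bigl(-C\int_0^{\bar T}\|\bar u(\tau,\cdot)\|_{H^{s+2}}\,d\tau\Bigr).$$ Let $0<T\le\bar T$, let $u\in L^\infty([0,T];H^{s+1}(\mathbb T^3))$ be a solution on $[0,T]$ of $$\partial_t u+u\cdot\nabla u+\nabla p=0,\qquad \nabla\cdot u=0,\qquad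 u(0)=\bar u_0+\varepsilon\tilde u_0,$$ let $\tilde u^{Lin}\in L^\infty([0,T];H^{s+1}(\mathbb T^3))$ be a solution on $[0,T]$ of the linearization around $\bar u$, $$\partial_t\tilde u^{Lin}+\bar u\cdot\nabla\tilde u^{Lin}+\tilde u^{Lin}\cdot\nabla\bar u+\nabla\tilde p^{Lin}=0,\qquad \nabla\cdot\tilde u^{Lin}=0,\qquad \tilde u^{Lin}(0)=\varepsilon\tilde u_0,$$ and put $u^{Lin}=\bar u+\tilde u^{Lin}$, $\omega=\nabla\times u$, $\omega^{Lin}=\nabla\times u^{Lin}$. (All solutions are taken in their continuously differentiable versions, the pressures being functions on $\mathbb T^3$.) Then for every $t\in[0,T]$ $$\|\omega(t,\cdot)-\omega^{Lin}(t,\cdot)\|_{L^\infty(\mathbb T^3)}\;\le\;\varepsilon^2\,\|\tilde u_0\|_{H^{s+1}}^2\,C\,\bar T\,\exp\Bigl(C\int_0^{\bar T}\|\bar u(\tau,\cdot)\|_{H^{s+2}}\,d\tau\Bigr).$$ In particular, if $u$ and $\tilde u^{Lin}$ are given on all of $[0,\bar T]$, the bound holds on $[0,\bar T]$. -/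

import Mathlib

open MeasureTheory Set

noncomputable section

namespace EulerTorus

/-- Euclidean three-space. Functions on the torus `[-L, L)³` are functions on `E3` that have
period `2L` in each coordinate. -/
abbrev E3 : Type := EuclideanSpace ℝ (Fin 3)

/-- `f` has period `2L` in each coordinate: it is a function on the torus `[-L, L)³`. -/
def IsPeriodic {α : Type*} (L : ℝ) (f : E3 → α) : Prop :=
  ∀ (x : E3) (i : Fin 3), f (x + EuclideanSpace.single i (2 * L)) = f x

/-- The fundamental cube `[-L, L)³`. -/
def cube (L : ℝ) : Set E3 := {x | ∀ i, x i ∈ Ico (-L) L}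

/-- The Fourier coefficient
`(2L)⁻³ ∫ f(x) exp(-i (π/L) k·x) dx`, the integral being over `[-L, L)³`. -/
def torusFourierCoeff (L : ℝ) (f : E3 → ℝ) (k : Fin 3 → ℤ) : ℂ :=
  ((2 * L : ℝ) : ℂ)⁻¹ ^ 3 *
    ∫ x in cube L, (f x : ℂ) *
      Complex.exp (-(((Real.pi / L) * ∑ i, (k i : ℝ) * x i : ℝ) : ℂ) * Complex.I)

/-- The symbol `1 + |πk/L|²` of `1 - Δ` on the torus `[-L, L)³`. -/
def besselSymbol (L : ℝ) (k : Fin 3 → ℤ) : ℝ :=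
  1 + ∑ i, (Real.pi / L * (k i : ℝ)) ^ 2

/-- The contribution of the frequency `k` to the squared `H^σ` norm of a vector field. -/
def sobolevTerm (L σ : ℝ) (f : E3 → E3) (k : Fin 3 → ℤ) : ℝ :=
  besselSymbol L k ^ σ * ∑ i, ‖torusFourierCoeff L (fun x => f x i) k‖ ^ 2

/-- `f` is a vector field on the torus `[-L, L)³` of class `H^σ` (for `σ ≥ 0`). -/
def MemSobolevTorus (L σ : ℝ) (f : E3 → E3) : Prop :=
  IsPeriodic L f ∧ MemLp f 2 (volume.restrict (cube L)) ∧ Summable (sobolevTerm L σ f)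

/-- The norm `‖(1 - Δ)^(σ/2) f‖` in `L²` of the torus `[-L, L)³`. -/
def sobolevNorm (L σ : ℝ) (f : E3 → E3) : ℝ :=
  Real.sqrt ((2 * L) ^ 3 * ∑' k, sobolevTerm L σ f k)

/-- The partial derivative `∂ᵢ vⱼ` at `x`. -/
def partialDeriv (v : E3 → E3) (i j : Fin 3) (x : E3) : ℝ :=
  (fderiv ℝ v x (EuclideanSpace.single i 1)) j

/-- The divergence `∇ · v`. -/
def divergence (v : E3 → E3) (x : E3) : ℝ := ∑ i, partialDeriv v i i x

/-- The curl `∇ × v`. -/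
def curl (v : E3 → E3) (x : E3) : E3 :=
  !₂[partialDeriv v 1 2 x - partialDeriv v 2 1 x,
     partialDeriv v 2 0 x - partialDeriv v 0 2 x,
     partialDeriv v 0 1 x - partialDeriv v 1 0 x]

/-- The advection term `(v · ∇) w` at `x`, that is `∑ᵢ vᵢ ∂ᵢ w`. -/
def advect (v w : E3 → E3) (x : E3) : E3 := fderiv ℝ w x (v x)

/-- A time-dependent divergence-free vector field on the torus, continuously differentiable on
`[0, T] × ℝ³` (so that the equations below can be read pointwise) and of class
`L^∞([0, T]; H^σ)`. The solutions considered here have `σ > 7/2`; a solution in the sense of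
distributions of that class agrees almost everywhere with a continuously differentiable one, and
for the latter the essential bound in time holds at every time. -/
structure IsSolenoidalFlow (L σ T : ℝ) (u : ℝ → E3 → E3) : Prop where
  contDiffOn : ContDiffOn ℝ 1 (fun z : ℝ × E3 => u z.1 z.2) (Icc 0 T ×ˢ univ)
  divergence_eq_zero : ∀ t ∈ Icc 0 T, ∀ x, divergence (u t) x = 0
  memSobolev : ∀ t ∈ Icc 0 T, MemSobolevTorus L σ (u t)
  bounded : ∃ M : ℝ, ∀ t ∈ Icc 0 T, sobolevNorm L σ (u t) ≤ M

/-- A pressure: at each time of `[0, T]` a continuously differentiable function on the torus. -/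
def IsPressure (L T : ℝ) (p : ℝ → E3 → ℝ) : Prop :=
  ∀ t ∈ Icc 0 T, ContDiff ℝ 1 (p t) ∧ IsPeriodic L (p t)

/-- `u`, of class `L^∞([0, T]; H^σ)`, solves the incompressible Euler equations on the torus,
`∂ₜ u + u · ∇u + ∇p = 0`, `∇ · u = 0`, `u(0) = u₀`. -/
structure IsEulerSolution (L σ T : ℝ) (u₀ : E3 → E3) (u : ℝ → E3 → E3) : Prop where
  flow : IsSolenoidalFlow L σ T u
  momentum : ∃ p : ℝ → E3 → ℝ, IsPressure L T p ∧ ∀ t ∈ Icc 0 T, ∀ x,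
    HasDerivWithinAt (fun τ => u τ x)
      (-(advect (u t) (u t) x + gradient (p t) x)) (Icc 0 T) t
  initial : u 0 =ᵐ[volume] u₀

/-- `v`, of class `L^∞([0, T]; H^σ)`, solves the Euler equations on the torus linearized around
`w`, `∂ₜ v + w · ∇v + v · ∇w + ∇q = 0`, `∇ · v = 0`, `v(0) = v₀`. -/
structure IsLinearizedEulerSolution (L σ T : ℝ) (w : ℝ → E3 → E3) (v₀ : E3 → E3)
    (v : ℝ → E3 → E3) : Prop where
  flow : IsSolenoidalFlow L σ T v
  momentum : ∃ q : ℝ → E3 → ℝ, IsPressure L T q ∧ ∀ t ∈ Icc 0 T, ∀ x,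
    HasDerivWithinAt (fun τ => v τ x)
      (-(advect (w t) (v t) x + advect (v t) (w t) x + gradient (q t) x)) (Icc 0 T) t
  initial : v 0 =ᵐ[volume] v₀

end EulerTorus

end

open EulerTorus

/-!
The three flows are compared through two difference fields. The perturbation `w = u - ū` solves
`∂ₜ w + u · ∇w + w · ∇ū + ∇q = 0` with initial value `ε ũ₀`, and the linearization error
`v = w - ũ` solves `∂ₜ v + ū · ∇v + v · ∇ū + w · ∇w + ∇q = 0` with initial value zero. Only the
quadratic term `w · ∇w` drives `v`, which is why the error is of order `ε²`. An `H^(s+1)` estimate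
for `w` loses one derivative on `ū` (hence the norm of `ū` in `H^(s+2)`); an `H^s` estimate for `v`
loses one derivative on `w`; and `H^s` controls the maximum of the curl because `s > 5/2`.

Both estimates are energy estimates on Fourier coefficients. With `⟨k⟩ = (1 + |πk/L|²)^(1/2)` and a
multiplier `a(k)`, the transport term contributes
`∑ₖ ∑ⱼ a(k)² Re K(k, j)`, where `Re K` is antisymmetric since the transporting field is real and
divergence free. So `a(k)²` may be replaced by `a(k) (a(k) - a(j))`, and for `a(k) = ⟨k⟩^σ` the
difference gains the derivative that `K` loses. The fields are not regular enough for these sums to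
converge absolutely at `a(k) = ⟨k⟩^σ`; the multiplier is therefore truncated to finitely many
frequencies by a Lipschitz factor (`cutoff`), for which the commutator bound
`abs_cutoff_sub_mul_le` holds uniformly in the truncation. The resulting static estimates are
`exists_abs_cutoffPairing_transport_le` and `exists_abs_cutoffPairing_advect_le`; the pressure drops
out by `cutoffPairing_neg_add_gradient`. Letting the truncation tend to infinity in the integrated
energy inequality gives `sq_modeNorm_le_add_integral`.

The norms are merely bounded and measurable in time, so the Grönwall inequalities are proved in
integral form, with absolutely continuous integrating factors. For `w` the inequality is
`y² ≤ y₀² + ∫ 2C (b + y) y²`: the linear Grönwall inequality with coefficient `2C (b + y)` gives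
`y exp (-C ∫ y) ≤ y₀ exp (C ∫ b)`, whose left side is, up to the factor `-C`, the derivative of
`exp (-C ∫ y)`; the smallness assumption on `ε` then bounds `exp (C ∫ y)` by `2`.
-/

open scoped ENNReal

noncomputable section

namespace EulerTorus

/-! ### Fourier analysis of periodic functions -/

/-- The character `exp(i (π/L) k·x)` of the torus `[-L, L)³`. -/
def torusChar (L : ℝ) (k : Fin 3 → ℤ) (x : E3) : ℂ :=
  Complex.exp ((((Real.pi / L) * ∑ i, (k i : ℝ) * x i : ℝ) : ℂ) * Complex.I)

/-- The Fourier coefficient of a complex-valued function on the torus `[-L, L)³`. -/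
def complexFourierCoeff (L : ℝ) (f : E3 → ℂ) (k : Fin 3 → ℤ) : ℂ :=
  ((2 * L : ℝ) : ℂ)⁻¹ ^ 3 * ∫ x in cube L, f x * torusChar L (-k) x

/-- The projection of `ℝ³` onto the torus, rescaled to side length one. -/
def toUnitTorus (L : ℝ) (x : E3) : UnitAddTorus (Fin 3) := fun i =>
  ((x i / (2 * L) : ℝ) : UnitAddCircle)

lemma torusChar_neg (L : ℝ) (k : Fin 3 → ℤ) (x : E3) :
    torusChar L (-k) x =
      Complex.exp (-(((Real.pi / L) * ∑ i, (k i : ℝ) * x i : ℝ) : ℂ) * Complex.I) := by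
  simp [torusChar, Finset.sum_neg_distrib]

lemma torusFourierCoeff_eq (L : ℝ) (f : E3 → ℝ) (k : Fin 3 → ℤ) :
    torusFourierCoeff L f k = complexFourierCoeff L (fun x => (f x : ℂ)) k := by
  simp only [torusFourierCoeff, complexFourierCoeff, torusChar_neg]

lemma torusChar_add (L : ℝ) (k l : Fin 3 → ℤ) (x : E3) :
    torusChar L (k + l) x = torusChar L k x * torusChar L l x := by
  rw [torusChar, torusChar, torusChar, ← Complex.exp_add]
  congr 1
  rw [← add_mul, ← Complex.ofReal_add, ← mul_add, ← Finset.sum_add_distrib]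
  simp [add_mul]

lemma norm_torusChar (L : ℝ) (k : Fin 3 → ℤ) (x : E3) : ‖torusChar L k x‖ = 1 :=
  Complex.norm_exp_ofReal_mul_I _

lemma conj_torusChar (L : ℝ) (k : Fin 3 → ℤ) (x : E3) :
    (starRingEnd ℂ) (torusChar L k x) = torusChar L (-k) x := by
  rw [torusChar_neg, torusChar, ← Complex.exp_conj]
  simp

lemma continuous_torusChar (L : ℝ) (k : Fin 3 → ℤ) : Continuous (torusChar L k) := by
  unfold torusChar; fun_prop

lemma mFourier_toUnitTorus {L : ℝ} (hL : 0 < L) (k : Fin 3 → ℤ) (x : E3) :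
    UnitAddTorus.mFourier k (toUnitTorus L x) = torusChar L k x := by
  simp only [UnitAddTorus.mFourier, ContinuousMap.coe_mk, toUnitTorus, fourier_coe_apply,
    torusChar]
  rw [← Complex.exp_sum]
  congr 1
  push_cast
  rw [Finset.mul_sum, Finset.sum_mul]
  refine Finset.sum_congr rfl fun i _ => ?_
  have : (L : ℂ) ≠ 0 := by exact_mod_cast hL.ne'
  field_simp

lemma isOpenQuotientMap_toUnitTorus {L : ℝ} (hL : 0 < L) :
    IsOpenQuotientMap (toUnitTorus L) := by
  have h1 : IsOpenQuotientMap (Pi.map (fun (_ : Fin 3) (y : ℝ) => (y : UnitAddCircle))) :=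
    IsOpenQuotientMap.piMap fun i => QuotientAddGroup.isOpenQuotientMap_mk
  have h2 : IsOpenQuotientMap (fun (x : E3) (i : Fin 3) => x i / (2 * L)) := by
    let e : E3 ≃ₜ (Fin 3 → ℝ) := (EuclideanSpace.equiv (Fin 3) ℝ).toHomeomorph.trans
      (Homeomorph.smulOfNeZero ((2 * L)⁻¹) (by positivity))
    have : (fun (x : E3) (i : Fin 3) => x i / (2 * L)) = e := by
      ext x i
      simp [e, div_eq_inv_mul]
    rw [this]
    exact e.isOpenQuotientMap
  exact h1.comp h2

lemma IsPeriodic.add_int {α : Type*} {L : ℝ} {f : E3 → α} (hf : IsPeriodic L f) (x : E3)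
    (i : Fin 3) (n : ℤ) : f (x + EuclideanSpace.single i (2 * L * n)) = f x := by
  have hs : ∀ a b : ℝ, (EuclideanSpace.single i (a + b) : E3) =
      EuclideanSpace.single i a + EuclideanSpace.single i b := by
    intro a b; ext j; by_cases h : j = i <;> simp [h]
  induction n using Int.induction_on with
  | zero =>
    have : (EuclideanSpace.single i (2 * L * ((0 : ℤ) : ℝ)) : E3) = 0 := by
      ext j; by_cases h : j = i <;> simp
    rw [this, add_zero]
  | succ n ih =>
    rw [show (2 * L * ((n + 1 : ℤ) : ℝ)) = 2 * L * ((n : ℤ) : ℝ) + 2 * L by push_cast; ring, hs,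
      ← add_assoc, hf, ih]
  | pred n ih =>
    rw [← hf, add_assoc, ← hs, ← ih]
    congr 3
    push_cast; ring

lemma IsPeriodic.eq_of_toUnitTorus_eq {α : Type*} {L : ℝ} (hL : 0 < L) {f : E3 → α}
    (hf : IsPeriodic L f) {x y : E3} (h : toUnitTorus L x = toUnitTorus L y) : f x = f y := by
  have h1 : ∀ i, ∃ n : ℤ, y i = x i + 2 * L * n := by
    intro i
    have h1 : (((y i / (2 * L) - x i / (2 * L) : ℝ)) : UnitAddCircle) = 0 := by
      rw [AddCircle.coe_sub, sub_eq_zero]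
      exact (congrFun h i).symm
    obtain ⟨n, hn⟩ := (AddCircle.coe_eq_zero_iff _).1 h1
    refine ⟨n, ?_⟩
    rw [zsmul_eq_mul, mul_one] at hn
    rw [hn]
    field_simp
    ring
  choose n hn using h1
  have : y = x + EuclideanSpace.single 0 (2 * L * n 0) + EuclideanSpace.single 1 (2 * L * n 1)
      + EuclideanSpace.single 2 (2 * L * n 2) := by
    ext i; fin_cases i <;> simp [hn]
  rw [this, hf.add_int, hf.add_int, hf.add_int]

lemma IsPeriodic.exists_lift {L : ℝ} (hL : 0 < L) {f : E3 → ℂ}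
    (hf : IsPeriodic L f) (hc : Continuous f) :
    ∃ F : C(UnitAddTorus (Fin 3), ℂ), ∀ x, F (toUnitTorus L x) = f x := by
  let q : C(E3, UnitAddTorus (Fin 3)) := ⟨toUnitTorus L, (isOpenQuotientMap_toUnitTorus hL).continuous⟩
  have hq : Topology.IsQuotientMap q := (isOpenQuotientMap_toUnitTorus hL).isQuotientMap
  have hfac : Function.FactorsThrough (⟨f, hc⟩ : C(E3, ℂ)) q :=
    fun a b h => hf.eq_of_toUnitTorus_eq hL h
  exact ⟨hq.lift ⟨f, hc⟩ hfac, fun x => DFunLike.congr_fun (hq.lift_comp ⟨f, hc⟩ hfac) x⟩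

-- the normalization used in Mathlib's definition of `UnitAddTorus.mFourierCoeff`, which has to take
-- precedence over the instance for circles of general length
local instance : MeasureSpace UnitAddCircle := ⟨AddCircle.haarAddCircle⟩

local instance : Measure.IsAddHaarMeasure (volume : Measure UnitAddCircle) :=
  inferInstanceAs (Measure.IsAddHaarMeasure AddCircle.haarAddCircle)

local instance : IsProbabilityMeasure (volume : Measure UnitAddCircle) :=
  inferInstanceAs (IsProbabilityMeasure AddCircle.haarAddCircle)

open scoped Pointwise in
/-- The integral over the fundamental cube as an integral over the torus of side length one. -/
lemma setIntegral_cube_comp_toUnitTorus {L : ℝ} (hL : 0 < L) (F : UnitAddTorus (Fin 3) → ℂ) :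
    ∫ x in cube L, F (toUnitTorus L x) = ((2 * L : ℝ) : ℂ) ^ 3 * ∫ t, F t := by
  have hL2 : 0 < 2 * L := by positivity
  have h1 : ∫ x in cube L, F (toUnitTorus L x) =
      ∫ x in {x : Fin 3 → ℝ | ∀ i, x i ∈ Ico (-L) L}, F (fun i => ((x i / (2 * L) : ℝ) : UnitAddCircle)) := by
    rw [← (PiLp.volume_preserving_toLp (Fin 3)).setIntegral_preimage_emb
      (MeasurableEquiv.toLp 2 (Fin 3 → ℝ)).measurableEmbedding]
    rfl
  have h2 : {x : Fin 3 → ℝ | ∀ i, x i ∈ Ico (-L) L} =ᵐ[volume]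
      (2 * L) • {x : Fin 3 → ℝ | ∀ i, x i ∈ Ioc ((-1/2 : ℝ)) (-1/2 + 1)} := by
    have e1 : {x : Fin 3 → ℝ | ∀ i, x i ∈ Ico (-L) L} = pi univ fun i => Ico (-L) L := by
      ext; simp
    have e2 : (2 * L) • {x : Fin 3 → ℝ | ∀ i, x i ∈ Ioc ((-1/2 : ℝ)) (-1/2 + 1)} =
        pi univ fun i => Ioc (-L) L := by
      ext x
      rw [Set.mem_smul_set_iff_inv_smul_mem₀ hL2.ne']
      simp only [mem_ofPred_eq, Pi.smul_apply, smul_eq_mul, mem_Ioc, mem_pi, mem_univ, true_imp_iff]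
      refine forall_congr' fun i => ?_
      rw [lt_inv_mul_iff₀ hL2, inv_mul_le_iff₀ hL2]
      constructor <;> rintro ⟨a, b⟩ <;> constructor <;> linarith
    rw [e1, e2]
    exact Measure.univ_pi_Ico_ae_eq_Icc.trans Measure.univ_pi_Ioc_ae_eq_Icc.symm
  rw [h1, setIntegral_congr_set h2, UnitAddTorus.integral_preimage F (fun _ => -1/2)]
  have h3 := Measure.setIntegral_comp_smul_of_pos (volume : Measure (Fin 3 → ℝ))
    (fun x => F (fun i => ((x i / (2 * L) : ℝ) : UnitAddCircle)))
    {x : Fin 3 → ℝ | ∀ i, x i ∈ Ioc ((-1/2 : ℝ)) (-1/2 + 1)} hL2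
  have h4 : ∀ y : ℝ, 2 * L * y / (2 * L) = y := fun y => by field_simp
  simp only [Pi.smul_apply, smul_eq_mul, h4, Module.finrank_fin_fun] at h3
  rw [h3, Complex.real_smul, ← mul_assoc]
  rw [Complex.ofReal_inv, Complex.ofReal_pow, mul_inv_cancel₀, one_mul]
  have : (L : ℂ) ≠ 0 := by exact_mod_cast hL.ne'
  simp [this]

lemma complexFourierCoeff_eq_mFourierCoeff {L : ℝ} (hL : 0 < L) {f : E3 → ℂ}
    {F : UnitAddTorus (Fin 3) → ℂ} (hF : ∀ x, F (toUnitTorus L x) = f x) (k : Fin 3 → ℤ) :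
    complexFourierCoeff L f k = UnitAddTorus.mFourierCoeff F k := by
  have := setIntegral_cube_comp_toUnitTorus hL (fun t => UnitAddTorus.mFourier (-k) t • F t)
  simp only [hF, mFourier_toUnitTorus hL, smul_eq_mul] at this
  simp only [complexFourierCoeff, mul_comm (f _), this, UnitAddTorus.mFourierCoeff, smul_eq_mul]
  rw [← mul_assoc, inv_pow, inv_mul_cancel₀, one_mul]
  have : (L : ℂ) ≠ 0 := by exact_mod_cast hL.ne'
  simp [this]

/-- Fourier inversion for continuous functions with summable Fourier coefficients. -/
lemma IsPeriodic.hasSum_torusChar {L : ℝ} (hL : 0 < L) {f : E3 → ℂ}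
    (hf : IsPeriodic L f) (hc : Continuous f) (hs : Summable (complexFourierCoeff L f)) (x : E3) :
    HasSum (fun k => complexFourierCoeff L f k * torusChar L k x) (f x) := by
  obtain ⟨F, hF⟩ := hf.exists_lift hL hc
  have e : complexFourierCoeff L f = UnitAddTorus.mFourierCoeff F :=
    funext fun k => complexFourierCoeff_eq_mFourierCoeff hL hF k
  rw [e] at hs ⊢
  have := UnitAddTorus.hasSum_mFourier_series_apply_of_summable hs (toUnitTorus L x)
  simpa [mFourier_toUnitTorus hL, hF] using this

/-- The integral over a period is invariant under translations. -/
lemma IsPeriodic.setIntegral_cube_translate {L : ℝ} (hL : 0 < L) {f : E3 → ℂ}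
    (hf : IsPeriodic L f) (hc : Continuous f) (y : E3) :
    ∫ x in cube L, f (x + y) = ∫ x in cube L, f x := by
  obtain ⟨F, hF⟩ := hf.exists_lift hL hc
  have hadd : ∀ x, toUnitTorus L (x + y) = toUnitTorus L x + toUnitTorus L y := by
    intro x; ext i; simp [toUnitTorus, add_div]
  have h1 := setIntegral_cube_comp_toUnitTorus hL F
  have h2 := setIntegral_cube_comp_toUnitTorus hL (fun t => F (t + toUnitTorus L y))
  simp only [← hadd, hF] at h1 h2
  rw [h1, h2]
  congr 1
  exact integral_add_right_eq_self (fun t => F t) (toUnitTorus L y)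

lemma measurableSet_cube (L : ℝ) : MeasurableSet (cube L) := by
  have : cube L = ⋂ i : Fin 3, (fun x : E3 => x i) ⁻¹' Ico (-L) L := by
    ext; simp [cube]
  rw [this]
  exact MeasurableSet.iInter fun i => (by fun_prop : Measurable fun x : E3 => x i) measurableSet_Ico

lemma isBounded_cube (L : ℝ) : Bornology.IsBounded (cube L) := by
  refine (Metric.isBounded_closedBall (x := (0 : E3)) (r := √(3 * L ^ 2))).subset fun x hx => ?_
  rw [mem_closedBall_zero_iff, EuclideanSpace.norm_eq]
  refine Real.sqrt_le_sqrt ?_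
  have : ∀ i, ‖x i‖ ^ 2 ≤ L ^ 2 := fun i => by
    rw [Real.norm_eq_abs, sq_abs]
    exact sq_le_sq' (hx i).1 (hx i).2.le
  simp only [Fin.sum_univ_three]
  linarith [this 0, this 1, this 2]

lemma volume_cube_lt_top (L : ℝ) : volume (cube L) < ⊤ := (isBounded_cube L).measure_lt_top

instance isFiniteMeasure_restrict_cube (L : ℝ) : IsFiniteMeasure (volume.restrict (cube L)) :=
  ⟨by simpa using volume_cube_lt_top L⟩

lemma integrableOn_cube {L : ℝ} {F : Type*} [NormedAddCommGroup F] {f : E3 → F}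
    (hc : Continuous f) : IntegrableOn f (cube L) :=
  (hc.locallyIntegrable.integrableOn_isCompact (isBounded_cube L).isCompact_closure).mono_set
    subset_closure

lemma IsPeriodic.exists_bound {L : ℝ} (hL : 0 < L) {f : E3 → ℂ} (hf : IsPeriodic L f)
    (hc : Continuous f) : ∃ M : ℝ, ∀ x, ‖f x‖ ≤ M := by
  obtain ⟨F, hF⟩ := hf.exists_lift hL hc
  exact ⟨‖F‖, fun x => hF x ▸ F.norm_coe_le_norm _⟩

lemma IsPeriodic.fderiv_periodic {L : ℝ} {F : Type*} [NormedAddCommGroup F] [NormedSpace ℝ F] {f : E3 → F}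
    (hf : IsPeriodic L f) : IsPeriodic L (fderiv ℝ f) := by
  intro x i
  rw [← fderiv_comp_add_right]
  congr 1
  exact funext fun y => hf y i

lemma IsPeriodic.comp {L : ℝ} {α β : Type*} {f : E3 → α} (hf : IsPeriodic L f) (g : α → β) :
    IsPeriodic L (fun x => g (f x)) := fun x i => congrArg g (hf x i)

lemma IsPeriodic.comp₂ {L : ℝ} {α β γ : Type*} {f : E3 → α} {f' : E3 → β} (hf : IsPeriodic L f)
    (hf' : IsPeriodic L f') (g : α → β → γ) : IsPeriodic L (fun x => g (f x) (f' x)) :=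
  fun x i => congrArg₂ g (hf x i) (hf' x i)

lemma isPeriodic_torusChar {L : ℝ} (hL : 0 < L) (k : Fin 3 → ℤ) : IsPeriodic L (torusChar L k) := by
  intro x i
  rw [← mFourier_toUnitTorus hL, ← mFourier_toUnitTorus hL]
  congr 1
  ext j
  by_cases h : j = i
  · subst h
    simp only [toUnitTorus, PiLp.add_apply, PiLp.single_apply, if_true, add_div]
    rw [div_self (by positivity), AddCircle.coe_add_period]
  · simp [toUnitTorus, h]

/-- Partial derivatives of periodic functions have mean zero, as the integral over a period is
translation invariant. -/
lemma IsPeriodic.setIntegral_cube_fderiv {L : ℝ} (hL : 0 < L) {f : E3 → ℂ} (hf : IsPeriodic L f)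
    (hc : ContDiff ℝ 1 f) (v : E3) : ∫ x in cube L, fderiv ℝ f x v = 0 := by
  have hd : Continuous fun x => fderiv ℝ f x v := by
    have := hc.continuous_fderiv one_ne_zero
    fun_prop
  obtain ⟨M, hM⟩ := (hf.fderiv_periodic.comp fun T => T v).exists_bound hL hd
  have key := hasDerivAt_integral_of_dominated_loc_of_deriv_le (μ := volume.restrict (cube L))
    (F := fun (h : ℝ) x => f (x + h • v)) (F' := fun (h : ℝ) x => fderiv ℝ f (x + h • v) v)
    (x₀ := 0) (bound := fun _ => M) Filter.univ_mem
    (Filter.Eventually.of_forall fun h => by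
      have := hc.continuous
      exact (by fun_prop : Continuous fun x => f (x + h • v)).aestronglyMeasurable)
    (by simpa using! integrableOn_cube hc.continuous)
    (by simpa using hd.aestronglyMeasurable)
    (Filter.Eventually.of_forall fun x h _ => hM _) (integrable_const _)
    (Filter.Eventually.of_forall fun x h _ => by
      have h1 : HasDerivAt (fun h : ℝ => x + h • v) v h := by
        simpa using ((hasDerivAt_id h).smul_const v).const_add x
      exact ((hc.differentiable one_ne_zero (x + h • v)).hasFDerivAt).comp_hasDerivAt h h1)
  have h2 := key.2
  simp only [hf.setIntegral_cube_translate hL hc.continuous, zero_smul, add_zero] at h2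
  exact h2.unique (hasDerivAt_const _ _)

lemma fderiv_torusChar_single (L : ℝ) (k : Fin 3 → ℤ) (x : E3) (i : Fin 3) :
    fderiv ℝ (torusChar L k) x (EuclideanSpace.single i 1) =
      ((Real.pi / L * k i : ℝ) : ℂ) * Complex.I * torusChar L k x := by
  have h1 : HasDerivAt (fun h : ℝ => torusChar L k (x + h • EuclideanSpace.single i 1))
      (((Real.pi / L * k i : ℝ) : ℂ) * Complex.I * torusChar L k x) 0 := by
    have e : (fun h : ℝ => torusChar L k (x + h • EuclideanSpace.single i 1)) = fun h : ℝ =>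
        Complex.exp ((((Real.pi / L * k i : ℝ) : ℂ) * Complex.I) * h +
          ((((Real.pi / L) * ∑ i, (k i : ℝ) * x i : ℝ) : ℂ) * Complex.I)) := by
      ext h
      rw [torusChar]
      congr 1
      have : ∑ j, (k j : ℝ) * (x + h • (EuclideanSpace.single i 1 : E3)) j =
          ∑ j, (k j : ℝ) * x j + k i * h := by
        simp [mul_add, Finset.sum_add_distrib]
      rw [this]
      push_cast
      ring
    rw [e]
    have h0 := ((((Complex.ofRealCLM.hasDerivAt (x := (0 : ℝ))).const_mul
      (((Real.pi / L * k i : ℝ) : ℂ) * Complex.I)).add_const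
      ((((Real.pi / L) * ∑ i, (k i : ℝ) * x i : ℝ) : ℂ) * Complex.I)).cexp)
    simp only [Complex.ofRealCLM_apply, Complex.ofReal_zero, mul_zero, zero_add, Complex.ofReal_one,
      mul_one] at h0
    rw [mul_comm (_ * Complex.I) (torusChar L k x)]
    exact h0
  have hd : DifferentiableAt ℝ (torusChar L k) x := by
    unfold torusChar; fun_prop
  have h2 : HasDerivAt (fun h : ℝ => x + h • (EuclideanSpace.single i 1 : E3))
      (EuclideanSpace.single i 1) 0 := by
    simpa using ((hasDerivAt_id (0 : ℝ)).smul_const (EuclideanSpace.single i 1 : E3)).const_add x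
  have h3 := (HasFDerivAt.comp_hasDerivAt (0 : ℝ) (f := fun h : ℝ => x + h • (EuclideanSpace.single i 1 : E3))
    (l := torusChar L k) (l' := fderiv ℝ (torusChar L k) x) (by simpa using hd.hasFDerivAt) h2)
  exact h3.unique h1

lemma contDiff_torusChar (L : ℝ) (k : Fin 3 → ℤ) : ContDiff ℝ 1 (torusChar L k) := by
  unfold torusChar
  have : ContDiff ℝ 1 (fun x : E3 => (((Real.pi / L) * ∑ i, (k i : ℝ) * x i : ℝ) : ℂ)) := by
    refine Complex.ofRealCLM.contDiff.comp (contDiff_const.mul (ContDiff.sum fun i _ =>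
      contDiff_const.mul ?_))
    exact (EuclideanSpace.proj (𝕜 := ℝ) i).contDiff
  exact (this.mul contDiff_const).cexp

lemma complexFourierCoeff_fderiv {L : ℝ} (hL : 0 < L) {f : E3 → ℂ} (hf : IsPeriodic L f)
    (hc : ContDiff ℝ 1 f) (i : Fin 3) (k : Fin 3 → ℤ) :
    complexFourierCoeff L (fun x => fderiv ℝ f x (EuclideanSpace.single i 1)) k =
      ((Real.pi / L * k i : ℝ) : ℂ) * Complex.I * complexFourierCoeff L f k := by
  have hχ := contDiff_torusChar L (-k)
  have h0 := IsPeriodic.setIntegral_cube_fderiv hL (f := fun x => f x * torusChar L (-k) x)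
    (hf.comp₂ (isPeriodic_torusChar hL (-k)) (fun a b => a * b)) (hc.mul hχ)
    (EuclideanSpace.single i 1)
  have e : ∀ x, fderiv ℝ (fun x => f x * torusChar L (-k) x) x (EuclideanSpace.single i 1) =
      fderiv ℝ f x (EuclideanSpace.single i 1) * torusChar L (-k) x -
      ((Real.pi / L * k i : ℝ) : ℂ) * Complex.I * (f x * torusChar L (-k) x) := by
    intro x
    rw [fderiv_fun_mul (hc.differentiable one_ne_zero x) (hχ.differentiable one_ne_zero x)]
    simp only [add_apply, smul_apply, smul_eq_mul,
      fderiv_torusChar_single]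
    push_cast
    simp only [Pi.neg_apply, Int.cast_neg]
    ring
  have hd : Continuous fun x => fderiv ℝ f x (EuclideanSpace.single i 1) := by
    have := hc.continuous_fderiv one_ne_zero
    fun_prop
  simp only [e] at h0
  have i1 : IntegrableOn (fun x => fderiv ℝ f x (EuclideanSpace.single i 1) *
      torusChar L (-k) x) (cube L) := integrableOn_cube (hd.mul hχ.continuous)
  have i2 : IntegrableOn (fun x => ((Real.pi / L * k i : ℝ) : ℂ) * Complex.I *
      (f x * torusChar L (-k) x)) (cube L) :=
    integrableOn_cube (continuous_const.mul (hc.continuous.mul hχ.continuous))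
  rw [integral_sub i1 i2, integral_const_mul, sub_eq_zero] at h0
  rw [complexFourierCoeff, complexFourierCoeff, h0]
  ring

lemma complexFourierCoeff_add {L : ℝ} {f g : E3 → ℂ} (hf : IntegrableOn f (cube L))
    (hg : IntegrableOn g (cube L)) (k : Fin 3 → ℤ) :
    complexFourierCoeff L (fun x => f x + g x) k =
      complexFourierCoeff L f k + complexFourierCoeff L g k := by
  have hb : ∀ {h : E3 → ℂ}, IntegrableOn h (cube L) →
      IntegrableOn (fun x => h x * torusChar L (-k) x) (cube L) := fun hh =>
    Integrable.mul_bdd (c := 1) hh (continuous_torusChar L _).aestronglyMeasurable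
      (Filter.Eventually.of_forall fun x => (norm_torusChar L _ x).le)
  simp only [complexFourierCoeff, add_mul]
  rw [integral_add (hb hf) (hb hg), mul_add]

lemma complexFourierCoeff_const_mul (L : ℝ) (c : ℂ) (f : E3 → ℂ) (k : Fin 3 → ℤ) :
    complexFourierCoeff L (fun x => c * f x) k = c * complexFourierCoeff L f k := by
  simp only [complexFourierCoeff, mul_assoc, integral_const_mul]
  ring

lemma complexFourierCoeff_congr_ae {L : ℝ} {f g : E3 → ℂ} (h : f =ᵐ[volume] g) (k : Fin 3 → ℤ) :
    complexFourierCoeff L f k = complexFourierCoeff L g k := by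
  rw [complexFourierCoeff, complexFourierCoeff]
  congr 1
  exact integral_congr_ae (ae_restrict_of_ae (h.mono fun x hx => by simp only [hx]))

lemma torusFourierCoeff_neg (L : ℝ) (f : E3 → ℝ) (k : Fin 3 → ℤ) :
    torusFourierCoeff L f (-k) = (starRingEnd ℂ) (torusFourierCoeff L f k) := by
  simp only [torusFourierCoeff_eq, complexFourierCoeff, map_mul, map_pow, map_inv₀,
    Complex.conj_ofReal, ← integral_conj, conj_torusChar]

/-- The Fourier coefficients of a product are the convolution of the Fourier coefficients. -/
lemma hasSum_complexFourierCoeff_mul {L : ℝ} (hL : 0 < L) {f g : E3 → ℂ} (hf : IsPeriodic L f)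
    (hfc : Continuous f) (hs : Summable (complexFourierCoeff L f)) (hg : Continuous g)
    (k : Fin 3 → ℤ) :
    HasSum (fun j => complexFourierCoeff L f (k - j) * complexFourierCoeff L g j)
      (complexFourierCoeff L (fun x => f x * g x) k) := by
  set F : (Fin 3 → ℤ) → E3 → ℂ := fun l x =>
    complexFourierCoeff L f l * (g x * torusChar L (-(k - l)) x) with hF
  have hint : ∀ l, Integrable (F l) (volume.restrict (cube L)) := fun l =>
    integrableOn_cube (continuous_const.mul (hg.mul (continuous_torusChar L _)))
  have hnorm : ∀ l, ∫ x in cube L, ‖F l x‖ = ‖complexFourierCoeff L f l‖ * ∫ x in cube L, ‖g x‖ := by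
    intro l
    simp only [hF, norm_mul, norm_torusChar, mul_one, integral_const_mul]
  have h1 := hasSum_integral_of_summable_integral_norm hint
    (by simp only [hnorm]; exact hs.norm.mul_right _)
  have h2 : ∀ x, ∑' l, F l x = f x * g x * torusChar L (-k) x := by
    intro x
    have := ((hf.hasSum_torusChar hL hfc hs x).mul_right (g x * torusChar L (-k) x)).tsum_eq
    rw [mul_assoc, ← this]
    refine tsum_congr fun l => ?_
    simp only [hF, show -(k - l) = l + -k by abel, torusChar_add]
    ring
  simp only [h2] at h1
  have h3 := h1.mul_left ((((2 * L : ℝ) : ℂ))⁻¹ ^ 3)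
  rw [← (Equiv.subLeft k).hasSum_iff] at h3
  refine h3.congr_fun ?_
  intro j
  simp only [hF, Function.comp_apply, Equiv.subLeft_apply, sub_sub_cancel, integral_const_mul]
  rw [complexFourierCoeff, complexFourierCoeff]
  ring

/-! ### Weighted sequence spaces over the dual lattice -/

/-- The Japanese bracket `⟨k⟩ = (1 + |πk/L|²)^(1/2)`, the symbol of `(1 - Δ)^(1/2)`. -/
def bracket (L : ℝ) (k : Fin 3 → ℤ) : ℝ := √(besselSymbol L k)

lemma one_le_besselSymbol (L : ℝ) (k : Fin 3 → ℤ) : 1 ≤ besselSymbol L k := by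
  unfold besselSymbol
  have : 0 ≤ ∑ i, (Real.pi / L * (k i : ℝ)) ^ 2 := Finset.sum_nonneg fun i _ => sq_nonneg _
  linarith

lemma one_le_bracket (L : ℝ) (k : Fin 3 → ℤ) : 1 ≤ bracket L k :=
  Real.one_le_sqrt.2 (one_le_besselSymbol L k)

lemma bracket_pos (L : ℝ) (k : Fin 3 → ℤ) : 0 < bracket L k :=
  one_pos.trans_le (one_le_bracket L k)

lemma besselSymbol_rpow (L σ : ℝ) (k : Fin 3 → ℤ) :
    besselSymbol L k ^ σ = (bracket L k ^ σ) ^ 2 := by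
  have h : besselSymbol L k = bracket L k ^ 2 :=
    (Real.sq_sqrt (zero_le_one.trans (one_le_besselSymbol L k))).symm
  rw [h, ← Real.rpow_natCast, ← Real.rpow_natCast, ← Real.rpow_mul (bracket_pos L k).le,
    ← Real.rpow_mul (bracket_pos L k).le, mul_comm]

/-- The wave vector `πk/L`. -/
def waveVector (L : ℝ) (k : Fin 3 → ℤ) : E3 := WithLp.toLp 2 fun i => Real.pi / L * (k i : ℝ)

lemma bracket_eq (L : ℝ) (k : Fin 3 → ℤ) : bracket L k = √(1 + ‖waveVector L k‖ ^ 2) := by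
  rw [bracket, besselSymbol, EuclideanSpace.norm_sq_eq]
  simp only [waveVector, Real.norm_eq_abs, sq_abs]

lemma norm_waveVector_le (L : ℝ) (k : Fin 3 → ℤ) : ‖waveVector L k‖ ≤ bracket L k := by
  rw [bracket_eq]
  exact Real.le_sqrt_of_sq_le (by linarith)

lemma bracket_add_le_norm (L : ℝ) (j l : Fin 3 → ℤ) :
    bracket L (j + l) ≤ bracket L j + ‖waveVector L l‖ := by
  have h1 : ‖waveVector L (j + l)‖ ≤ ‖waveVector L j‖ + ‖waveVector L l‖ := by
    have : waveVector L (j + l) = waveVector L j + waveVector L l := by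
      ext i; simp [waveVector, mul_add]
    rw [this]; exact norm_add_le _ _
  have h2 := norm_waveVector_le L j
  have h3 : bracket L j ^ 2 = 1 + ‖waveVector L j‖ ^ 2 := by
    rw [bracket_eq, Real.sq_sqrt (by positivity)]
  rw [bracket_eq L (j + l)]
  have h4 := bracket_pos L j
  apply Real.sqrt_le_iff.2 ⟨by positivity, ?_⟩
  nlinarith [norm_nonneg (waveVector L (j + l)), norm_nonneg (waveVector L j),
    norm_nonneg (waveVector L l)]

lemma bracket_neg (L : ℝ) (k : Fin 3 → ℤ) : bracket L (-k) = bracket L k := by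
  simp [bracket, besselSymbol]

lemma bracket_le_add (L : ℝ) (k j : Fin 3 → ℤ) : bracket L k ≤ bracket L j + bracket L (k - j) := by
  have := bracket_add_le_norm L j (k - j)
  rw [add_sub_cancel] at this
  linarith [norm_waveVector_le L (k - j)]

lemma abs_bracket_sub_le (L : ℝ) (k j : Fin 3 → ℤ) :
    |bracket L k - bracket L j| ≤ bracket L (k - j) := by
  have h1 := bracket_le_add L k j
  have h2 := bracket_le_add L j k
  rw [← neg_sub, bracket_neg] at h2
  rw [abs_le]
  constructor <;> linarith

lemma summable_bracket_rpow {L : ℝ} (hL : 0 < L) {p : ℝ} (hp : 3 < p) :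
    Summable fun k => bracket L k ^ (-p) := by
  set c := Real.pi / L with hc
  have hc0 : 0 < c := by positivity
  -- in one dimension, `∑ (1 + c² n²)^(-p/6)` converges because `p/3 > 1`
  have h1 : Summable fun n : ℤ => (1 + (c * (n : ℝ)) ^ 2) ^ (-(p / 6)) := by
    have h2 : Summable fun n : ℤ => (|(n : ℝ)| ^ (-(p / 3))) * c ^ (-(p / 3)) :=
      (Real.summable_abs_int_rpow (by linarith)).mul_right _
    refine Summable.of_norm_bounded_eventually h2 ?_
    rw [Filter.eventually_cofinite]
    refine (Set.finite_singleton (0 : ℤ)).subset fun n hn => ?_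
    by_contra h0
    apply hn
    have hn0 : (0 : ℝ) < |(n : ℝ)| := abs_pos.2 (by exact_mod_cast h0)
    rw [Real.norm_of_nonneg (by positivity), ← Real.mul_rpow hn0.le hc0.le,
      show -(p / 3) = ((2 : ℕ) : ℝ) * -(p / 6) by push_cast; ring, Real.rpow_mul (by positivity),
      Real.rpow_natCast]
    refine Real.rpow_le_rpow_of_nonpos (by positivity) ?_ (by linarith)
    rw [mul_pow, sq_abs, mul_pow]
    nlinarith
  have h3 : Summable fun k : Fin 3 → ℤ => ∏ i, (1 + (c * (k i : ℝ)) ^ 2) ^ (-(p / 6)) := by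
    have h4 : Summable fun q : ℤ × ℤ × ℤ => (1 + (c * (q.1 : ℝ)) ^ 2) ^ (-(p / 6)) *
        ((1 + (c * (q.2.1 : ℝ)) ^ 2) ^ (-(p / 6)) * (1 + (c * (q.2.2 : ℝ)) ^ 2) ^ (-(p / 6))) :=
      h1.mul_of_nonneg (h1.mul_of_nonneg h1 (fun _ => by positivity) (fun _ => by positivity))
        (fun _ => by positivity) (fun _ => by dsimp only; positivity)
    let e : (Fin 3 → ℤ) ≃ ℤ × ℤ × ℤ :=
      { toFun := fun k => (k 0, k 1, k 2)
        invFun := fun q => ![q.1, q.2.1, q.2.2]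
        left_inv := fun k => by ext i; fin_cases i <;> rfl
        right_inv := fun q => rfl }
    refine (e.summable_iff.2 h4).congr fun k => ?_
    rw [Fin.prod_univ_three, mul_assoc]
    rfl
  refine Summable.of_nonneg_of_le (fun k => (Real.rpow_pos_of_pos (bracket_pos L k) _).le)
    (fun k => ?_) h3
  have hb := zero_le_one.trans (one_le_besselSymbol L k)
  have h5 : bracket L k ^ (-p) = ∏ _i : Fin 3, besselSymbol L k ^ (-(p / 6)) := by
    rw [Finset.prod_const, Finset.card_univ, Fintype.card_fin, bracket, Real.sqrt_eq_rpow,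
      ← Real.rpow_mul hb, ← Real.rpow_natCast, ← Real.rpow_mul hb]
    congr 1; push_cast; ring
  rw [h5]
  refine Finset.prod_le_prod (fun i _ => Real.rpow_nonneg hb _) fun i _ => ?_
  refine Real.rpow_le_rpow_of_nonpos (by positivity) ?_ (by linarith)
  rw [besselSymbol]
  have := Finset.single_le_sum (f := fun i => (Real.pi / L * (k i : ℝ)) ^ 2)
    (fun i _ => sq_nonneg _) (Finset.mem_univ i)
  linarith

lemma finite_setOf_bracket_lt {L : ℝ} (hL : 0 < L) (r : ℝ) : {k | bracket L k < r}.Finite := by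
  have h := (summable_bracket_rpow hL (p := 4) (by norm_num)).tendsto_cofinite_zero
  by_cases hr : 0 < r
  · have := h.eventually (gt_mem_nhds (Real.rpow_pos_of_pos hr (-4)))
    rw [Filter.eventually_cofinite] at this
    refine this.subset fun k hk => ?_
    have := Real.rpow_le_rpow_of_nonpos (bracket_pos L k) (le_of_lt hk) (by norm_num : (-4 : ℝ) ≤ 0)
    simpa using this
  · refine Set.finite_empty.subset fun k hk => hr ((bracket_pos L k).trans hk)

/-- The bracket as an extended nonnegative real. -/
def weight (L : ℝ) (k : Fin 3 → ℤ) : ℝ≥0∞ := ENNReal.ofReal (bracket L k)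

/-- The `ℓ²` norm, with values in `[0, ∞]`. -/
def ellTwo {ι : Type*} (a : ι → ℝ≥0∞) : ℝ≥0∞ := (∑' k, a k ^ 2) ^ (1 / 2 : ℝ)

lemma tsum_mul_le_ellTwo {ι : Type*} (a b : ι → ℝ≥0∞) :
    ∑' k, a k * b k ≤ ellTwo a * ellTwo b := by
  let _ : MeasurableSpace ι := ⊤
  have := ENNReal.lintegral_mul_le_Lp_mul_Lq (Measure.count : Measure ι)
    (p := 2) (q := 2) (by constructor <;> norm_num) (f := a) (g := b)
    (measurable_from_top).aemeasurable measurable_from_top.aemeasurable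
  simp only [lintegral_count, Pi.mul_apply] at this
  simpa [ellTwo] using this

lemma ellTwo_comp_equiv {ι κ : Type*} (e : ι ≃ κ) (a : κ → ℝ≥0∞) :
    ellTwo (fun k => a (e k)) = ellTwo a := by
  rw [ellTwo, ellTwo, e.tsum_eq (fun k => a k ^ 2)]

/-- Young's inequality in trilinear form: `ℓ² * ℓ¹ * ℓ²`. -/
lemma tsum_tsum_mul_sub_mul_le {G : Type*} [AddCommGroup G] (f g h : G → ℝ≥0∞) :
    ∑' k, ∑' j, f k * g (k - j) * h j ≤ ellTwo f * (∑' l, g l) * ellTwo h := by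
  have h1 : ∀ k, ∑' j, f k * g (k - j) * h j = ∑' l, g l * (f k * h (k - l)) := fun k => by
    rw [← (Equiv.subLeft k).tsum_eq]
    refine tsum_congr fun l => ?_
    simp only [Equiv.subLeft_apply, sub_sub_cancel]
    ring
  simp only [h1]
  rw [ENNReal.tsum_comm]
  simp only [ENNReal.tsum_mul_left]
  calc ∑' l, g l * ∑' k, f k * h (k - l) ≤ ∑' l, g l * (ellTwo f * ellTwo h) := by
        refine ENNReal.tsum_le_tsum fun l => ?_
        gcongr
        refine (tsum_mul_le_ellTwo f fun k => h (k - l)).trans_eq ?_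
        exact congrArg _ (ellTwo_comp_equiv (Equiv.subRight l) h)
    _ = ellTwo f * (∑' l, g l) * ellTwo h := by rw [ENNReal.tsum_mul_right]; ring

/-- Young's inequality in trilinear form: `ℓ² * ℓ² * ℓ¹`. -/
lemma tsum_tsum_mul_sub_mul_le' {G : Type*} [AddCommGroup G] (f g h : G → ℝ≥0∞) :
    ∑' k, ∑' j, f k * g (k - j) * h j ≤ ellTwo f * ellTwo g * (∑' l, h l) := by
  have h1 : ∀ k, ∑' j, f k * g (k - j) * h j = ∑' j, f k * h (k - j) * g j := fun k => by
    rw [← (Equiv.subLeft k).tsum_eq]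
    refine tsum_congr fun l => ?_
    simp only [Equiv.subLeft_apply, sub_sub_cancel]
    ring
  simp only [h1]
  exact (tsum_tsum_mul_sub_mul_le f h g).trans_eq (by ring)

/-- The `H^σ` norm of a sequence of amplitudes, with values in `[0, ∞]`. -/
def seqNorm (L σ : ℝ) (a : (Fin 3 → ℤ) → ℝ≥0∞) : ℝ≥0∞ := ellTwo fun k => weight L k ^ σ * a k

lemma one_le_weight (L : ℝ) (k : Fin 3 → ℤ) : 1 ≤ weight L k := by
  simpa [weight] using one_le_bracket L k

lemma weight_ne_zero (L : ℝ) (k : Fin 3 → ℤ) : weight L k ≠ 0 :=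
  (zero_lt_one.trans_le (one_le_weight L k)).ne'

lemma weight_ne_top (L : ℝ) (k : Fin 3 → ℤ) : weight L k ≠ ∞ := ENNReal.ofReal_ne_top

lemma weight_rpow (L σ : ℝ) (k : Fin 3 → ℤ) :
    weight L k ^ σ = ENNReal.ofReal (bracket L k ^ σ) :=
  ENNReal.ofReal_rpow_of_pos (bracket_pos L k)

/-- The embedding of `H^σ` into the weighted `ℓ¹` space of order `τ`, for `σ > τ + 3/2`. -/
lemma exists_tsum_weight_mul_le {L : ℝ} (hL : 0 < L) {σ τ : ℝ} (h : τ + 3 / 2 < σ) :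
    ∃ C : ℝ≥0∞, C ≠ ∞ ∧ ∀ a : (Fin 3 → ℤ) → ℝ≥0∞,
      ∑' k, weight L k ^ τ * a k ≤ C * seqNorm L σ a := by
  refine ⟨ellTwo fun k => weight L k ^ (τ - σ), ?_, fun a => ?_⟩
  · refine ENNReal.rpow_ne_top_of_nonneg (by norm_num) ?_
    have h1 := (summable_bracket_rpow hL (p := 2 * (σ - τ)) (by linarith)).tsum_ofReal_ne_top
    convert h1 using 4 with k
    dsimp only
    rw [weight_rpow, ← ENNReal.ofReal_pow (Real.rpow_nonneg (bracket_pos L k).le _),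
      ← Real.rpow_natCast, ← Real.rpow_mul (bracket_pos L k).le]
    congr 2; push_cast; ring
  · refine le_trans (le_of_eq (tsum_congr fun k => ?_)) (tsum_mul_le_ellTwo _ _)
    rw [← mul_assoc, ← ENNReal.rpow_add _ _ (weight_ne_zero L k) (weight_ne_top L k),
      sub_add_cancel]

/-- The trilinear form of the algebra property of `H^σ`, `σ > 3/2`. -/
lemma exists_tsum_tsum_product_le {L : ℝ} (hL : 0 < L) {σ : ℝ} (hσ : 3 / 2 < σ) :
    ∃ C : ℝ≥0∞, C ≠ ∞ ∧ ∀ z f h : (Fin 3 → ℤ) → ℝ≥0∞,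
      ∑' k, ∑' j, (weight L k ^ σ * z k) * (weight L k ^ σ * (f (k - j) * h j)) ≤
        C * (seqNorm L σ z * seqNorm L σ f * seqNorm L σ h) := by
  obtain ⟨K, hK, hK'⟩ := exists_tsum_weight_mul_le hL (σ := σ) (τ := 0) (by linarith)
  simp only [ENNReal.rpow_zero, one_mul] at hK'
  have h2 : (2 : ℝ≥0∞) ^ σ ≠ ∞ := ENNReal.rpow_ne_top_of_nonneg (by linarith) (by simp)
  refine ⟨2 ^ σ * (2 * K), ENNReal.mul_ne_top h2 (ENNReal.mul_ne_top (by simp) hK),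
    fun z f h => ?_⟩
  have hw : ∀ k j, weight L k ^ σ ≤ 2 ^ σ * (weight L j ^ σ + weight L (k - j) ^ σ) := by
    intro k j
    have h1 : weight L k ≤ weight L j + weight L (k - j) := by
      rw [weight, weight, weight, ← ENNReal.ofReal_add (bracket_pos L j).le (bracket_pos L _).le]
      exact ENNReal.ofReal_le_ofReal (bracket_le_add L k j)
    have h3 : weight L k ≤ 2 * max (weight L j) (weight L (k - j)) := by
      rw [two_mul]
      exact h1.trans (add_le_add (le_max_left _ _) (le_max_right _ _))
    calc weight L k ^ σ ≤ (2 * max (weight L j) (weight L (k - j))) ^ σ := by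
          gcongr
      _ = 2 ^ σ * max (weight L j) (weight L (k - j)) ^ σ :=
          ENNReal.mul_rpow_of_nonneg _ _ (by linarith)
      _ ≤ _ := by
          gcongr
          rcases le_total (weight L j) (weight L (k - j)) with h | h
          · rw [max_eq_right h]; exact le_add_self
          · rw [max_eq_left h]; exact le_self_add
  calc ∑' k, ∑' j, (weight L k ^ σ * z k) * (weight L k ^ σ * (f (k - j) * h j))
      ≤ ∑' k, ∑' j, 2 ^ σ * ((weight L k ^ σ * z k) * f (k - j) * (weight L j ^ σ * h j) +
          (weight L k ^ σ * z k) * (weight L (k - j) ^ σ * f (k - j)) * h j) := by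
        refine ENNReal.tsum_le_tsum fun k => ENNReal.tsum_le_tsum fun j => ?_
        calc _ ≤ (weight L k ^ σ * z k) *
              ((2 ^ σ * (weight L j ^ σ + weight L (k - j) ^ σ)) * (f (k - j) * h j)) := by
              gcongr; exact hw k j
          _ = _ := by ring
    _ = 2 ^ σ * (∑' k, ∑' j, (weight L k ^ σ * z k) * f (k - j) * (weight L j ^ σ * h j) +
          ∑' k, ∑' j, (weight L k ^ σ * z k) * (weight L (k - j) ^ σ * f (k - j)) * h j) := by
        simp only [ENNReal.tsum_mul_left, ENNReal.tsum_add]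
    _ ≤ 2 ^ σ * (seqNorm L σ z * (K * seqNorm L σ f) * seqNorm L σ h +
          seqNorm L σ z * seqNorm L σ f * (K * seqNorm L σ h)) := by
        gcongr
        · refine (tsum_tsum_mul_sub_mul_le (fun k => weight L k ^ σ * z k) f
            (fun k => weight L k ^ σ * h k)).trans ?_
          exact mul_le_mul_left (mul_le_mul_right (hK' f) _) _
        · refine (tsum_tsum_mul_sub_mul_le' (fun k => weight L k ^ σ * z k)
            (fun k => weight L k ^ σ * f k) h).trans ?_
          exact mul_le_mul_right (hK' h) _
    _ = _ := by ring

/-- The trilinear form of the commutator estimate for a multiplier `a` of order `σ > 5/2`. -/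
lemma exists_tsum_tsum_commutator_le {L : ℝ} (hL : 0 < L) {σ : ℝ} (hσ : 5 / 2 < σ)
    (B : ℝ≥0∞) (hB : B ≠ ∞) :
    ∃ C : ℝ≥0∞, C ≠ ∞ ∧ ∀ (z f h : (Fin 3 → ℤ) → ℝ≥0∞) (D : (Fin 3 → ℤ) → (Fin 3 → ℤ) → ℝ≥0∞),
      (∀ k j, D k j * weight L j ≤
        B * (weight L (k - j) * weight L j ^ σ + weight L (k - j) ^ σ * weight L j)) →
      ∑' k, ∑' j, (weight L k ^ σ * z k) * (D k j * (f (k - j) * (weight L j * h j))) ≤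
        C * (seqNorm L σ z * seqNorm L σ f * seqNorm L σ h) := by
  obtain ⟨K, hK, hK'⟩ := exists_tsum_weight_mul_le hL (σ := σ) (τ := 1) (by linarith)
  simp only [ENNReal.rpow_one] at hK'
  refine ⟨B * (2 * K), ENNReal.mul_ne_top hB (ENNReal.mul_ne_top (by simp) hK),
    fun z f h D hD => ?_⟩
  calc ∑' k, ∑' j, (weight L k ^ σ * z k) * (D k j * (f (k - j) * (weight L j * h j)))
      ≤ ∑' k, ∑' j, B * ((weight L k ^ σ * z k) * (weight L (k - j) * f (k - j)) *
            (weight L j ^ σ * h j) +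
          (weight L k ^ σ * z k) * (weight L (k - j) ^ σ * f (k - j)) * (weight L j * h j)) := by
        refine ENNReal.tsum_le_tsum fun k => ENNReal.tsum_le_tsum fun j => ?_
        calc _ = (weight L k ^ σ * z k) * ((D k j * weight L j) * (f (k - j) * h j)) := by ring
          _ ≤ (weight L k ^ σ * z k) * ((B * (weight L (k - j) * weight L j ^ σ +
                weight L (k - j) ^ σ * weight L j)) * (f (k - j) * h j)) := by
              exact mul_le_mul_right (mul_le_mul_left (hD k j) _) _
          _ = _ := by ring
    _ = B * (∑' k, ∑' j, (weight L k ^ σ * z k) * (weight L (k - j) * f (k - j)) *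
            (weight L j ^ σ * h j) +
          ∑' k, ∑' j, (weight L k ^ σ * z k) * (weight L (k - j) ^ σ * f (k - j)) *
            (weight L j * h j)) := by
        simp only [ENNReal.tsum_mul_left, ENNReal.tsum_add]
    _ ≤ B * (seqNorm L σ z * (K * seqNorm L σ f) * seqNorm L σ h +
          seqNorm L σ z * seqNorm L σ f * (K * seqNorm L σ h)) := by
        gcongr
        · refine (tsum_tsum_mul_sub_mul_le (fun k => weight L k ^ σ * z k)
            (fun k => weight L k * f k) (fun k => weight L k ^ σ * h k)).trans ?_
          exact mul_le_mul_left (mul_le_mul_right (hK' f) _) _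
        · refine (tsum_tsum_mul_sub_mul_le' (fun k => weight L k ^ σ * z k)
            (fun k => weight L k ^ σ * f k) (fun k => weight L k * h k)).trans ?_
          exact mul_le_mul_right (hK' h) _
    _ = _ := by ring

/-! ### The truncated multiplier -/

/-- The multiplier `r^σ`, cut off at height `n` by a Lipschitz factor. A sharp cutoff would not
satisfy the commutator estimate. -/
def cutoff (σ n r : ℝ) : ℝ := r ^ σ * max 0 (1 - r / n)

lemma cutoff_nonneg {σ n r : ℝ} (hr : 0 ≤ r) : 0 ≤ cutoff σ n r :=
  mul_nonneg (Real.rpow_nonneg hr _) (le_max_left _ _)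

lemma cutoff_le {σ n r : ℝ} (hn : 0 < n) (hr : 0 ≤ r) : cutoff σ n r ≤ r ^ σ := by
  refine mul_le_of_le_one_right (Real.rpow_nonneg hr _) (max_le zero_le_one ?_)
  linarith [div_nonneg hr hn.le]

lemma cutoff_eq_zero {σ n r : ℝ} (hn : 0 < n) (hr : n ≤ r) : cutoff σ n r = 0 := by
  rw [cutoff, max_eq_left, mul_zero]
  have := (one_le_div hn).2 hr
  linarith

lemma abs_cutoff_sub_le_of_le {σ n r ρ : ℝ} (hσ : 1 ≤ σ) (hn : 0 < n) (hr : 0 < r) (h : r ≤ ρ) :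
    |cutoff σ n r - cutoff σ n ρ| ≤ (σ + 1) * ρ ^ (σ - 1) * (ρ - r) := by
  have hρ : 0 < ρ := hr.trans_le h
  by_cases hrn : n ≤ r
  · rw [cutoff_eq_zero hn hrn, cutoff_eq_zero hn (hrn.trans h), sub_zero, abs_zero]
    have : 0 ≤ ρ - r := sub_nonneg.2 h
    positivity
  push Not at hrn
  have e : cutoff σ n r - cutoff σ n ρ = r ^ σ * (max 0 (1 - r / n) - max 0 (1 - ρ / n)) -
      (ρ ^ σ - r ^ σ) * max 0 (1 - ρ / n) := by
    unfold cutoff; ring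
  have h1 : |max 0 (1 - r / n) - max 0 (1 - ρ / n)| ≤ (ρ - r) / n := by
    rw [max_comm, max_comm 0]
    refine (abs_max_sub_max_le_abs _ _ _).trans_eq ?_
    rw [show 1 - r / n - (1 - ρ / n) = (ρ - r) / n by ring,
      abs_of_nonneg (div_nonneg (sub_nonneg.2 h) hn.le)]
  have h2 : r ^ σ * ((ρ - r) / n) ≤ ρ ^ (σ - 1) * (ρ - r) := by
    have : r ^ σ = r ^ (σ - 1) * r := by
      rw [← Real.rpow_add_one hr.ne', sub_add_cancel]
    rw [this]
    have h3 : r / n ≤ 1 := (div_le_one hn).2 hrn.le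
    have h4 : r ^ (σ - 1) ≤ ρ ^ (σ - 1) := Real.rpow_le_rpow hr.le h (by linarith)
    have h5 : 0 ≤ ρ - r := sub_nonneg.2 h
    calc r ^ (σ - 1) * r * ((ρ - r) / n) = r ^ (σ - 1) * (r / n) * (ρ - r) := by ring
      _ ≤ ρ ^ (σ - 1) * 1 * (ρ - r) := by gcongr
      _ = _ := by ring
  -- Bernoulli's inequality at `r / ρ`
  have h3 : ρ ^ σ - r ^ σ ≤ σ * ρ ^ (σ - 1) * (ρ - r) := by
    have hb := one_add_mul_self_le_rpow_one_add (s := r / ρ - 1) (p := σ)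
      (by linarith [div_nonneg hr.le hρ.le]) hσ
    rw [add_sub_cancel, Real.div_rpow hr.le hρ.le, le_div_iff₀ (Real.rpow_pos_of_pos hρ _)] at hb
    have hρσ : ρ ^ σ = ρ ^ (σ - 1) * ρ := by
      rw [← Real.rpow_add_one hρ.ne', sub_add_cancel]
    have : σ * (r / ρ - 1) * ρ ^ σ = σ * ρ ^ (σ - 1) * (r - ρ) := by
      rw [hρσ]; field_simp
    nlinarith
  have h4 : 0 ≤ ρ ^ σ - r ^ σ := sub_nonneg.2 (Real.rpow_le_rpow hr.le h (by linarith))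
  have h5 : max 0 (1 - ρ / n) ≤ 1 :=
    max_le zero_le_one (by linarith [div_nonneg hρ.le hn.le])
  rw [e]
  refine (abs_sub _ _).trans ?_
  rw [abs_mul, abs_mul, abs_of_nonneg (Real.rpow_nonneg hr.le σ), abs_of_nonneg h4,
    abs_of_nonneg (le_max_left 0 (1 - ρ / n))]
  have h6 := mul_le_mul_of_nonneg_left h1 (Real.rpow_nonneg hr.le σ)
  have h7 := mul_le_of_le_one_right h4 h5
  linarith

/-- The pointwise bound behind the commutator estimate, uniform in the height of the cutoff. -/
lemma abs_cutoff_sub_mul_le {σ n r ρ d : ℝ} (hσ : 1 ≤ σ) (hn : 0 < n) (hr : 0 < r) (hρ : 0 < ρ)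
    (hd : 0 < d) (h : |r - ρ| ≤ d) :
    |cutoff σ n r - cutoff σ n ρ| * ρ ≤
      (σ + 1) * 2 ^ (σ - 1) * (d * ρ ^ σ + d ^ σ * ρ) := by
  have h1 : |cutoff σ n r - cutoff σ n ρ| ≤ (σ + 1) * max r ρ ^ (σ - 1) * |r - ρ| := by
    rcases le_total r ρ with hle | hle
    · rw [max_eq_right hle, abs_sub_comm r, abs_of_nonneg (sub_nonneg.2 hle)]
      exact abs_cutoff_sub_le_of_le hσ hn hr hle
    · rw [max_eq_left hle, abs_of_nonneg (sub_nonneg.2 hle), abs_sub_comm]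
      exact abs_cutoff_sub_le_of_le hσ hn hρ hle
  have h2 : max r ρ ^ (σ - 1) ≤ 2 ^ (σ - 1) * (ρ ^ (σ - 1) + d ^ (σ - 1)) := by
    have h3 : max r ρ ≤ 2 * max ρ d := by
      have := (abs_le.1 h).2
      refine max_le ?_ ?_ <;> linarith [le_max_left ρ d, le_max_right ρ d]
    calc max r ρ ^ (σ - 1) ≤ (2 * max ρ d) ^ (σ - 1) :=
          Real.rpow_le_rpow (hr.le.trans (le_max_left _ _)) h3 (by linarith)
      _ = 2 ^ (σ - 1) * max ρ d ^ (σ - 1) :=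
          Real.mul_rpow (by norm_num) (hρ.le.trans (le_max_left _ _))
      _ ≤ _ := by
          gcongr
          have := Real.rpow_nonneg hρ.le (σ - 1)
          have := Real.rpow_nonneg hd.le (σ - 1)
          rcases le_total ρ d with hle | hle
          · rw [max_eq_right hle]; linarith
          · rw [max_eq_left hle]; linarith
  have e1 : ρ ^ σ = ρ ^ (σ - 1) * ρ := by rw [← Real.rpow_add_one hρ.ne', sub_add_cancel]
  have e2 : d ^ σ = d ^ (σ - 1) * d := by rw [← Real.rpow_add_one hd.ne', sub_add_cancel]
  calc |cutoff σ n r - cutoff σ n ρ| * ρ ≤ ((σ + 1) * max r ρ ^ (σ - 1) * |r - ρ|) * ρ := by gcongr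
    _ ≤ ((σ + 1) * (2 ^ (σ - 1) * (ρ ^ (σ - 1) + d ^ (σ - 1))) * d) * ρ := by gcongr
    _ = _ := by rw [e1, e2]; ring

/-! ### Vector fields and their Fourier coefficients -/

/-- The vector of Fourier coefficients of a vector field at the frequency `k`. -/
def vecCoeff (L : ℝ) (f : E3 → E3) (k : Fin 3 → ℤ) : EuclideanSpace ℂ (Fin 3) :=
  WithLp.toLp 2 fun i => torusFourierCoeff L (fun x => f x i) k

/-- The symbol `i (π/L) kᵢ` of `∂ᵢ`. -/
def derivSymbol (L : ℝ) (k : Fin 3 → ℤ) (i : Fin 3) : ℂ := ((Real.pi / L * k i : ℝ) : ℂ) * Complex.I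

/-- The norm `√(∑ ⟨k⟩^(2σ) |f̂(k)|²)`, which is `(2L)^(-3/2)` times the `H^σ` norm. -/
def modeNorm (L σ : ℝ) (f : E3 → E3) : ℝ := √(∑' k, sobolevTerm L σ f k)

/-- A divergence-free field on the torus which is continuously differentiable and of class `H^σ`. -/
structure IsSolenoidalField (L σ : ℝ) (f : E3 → E3) : Prop where
  periodic : IsPeriodic L f
  contDiff : ContDiff ℝ 1 f
  divergence_eq_zero : ∀ x, divergence f x = 0
  summable : Summable (sobolevTerm L σ f)

lemma sobolevTerm_eq (L σ : ℝ) (f : E3 → E3) (k : Fin 3 → ℤ) :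
    sobolevTerm L σ f k = (bracket L k ^ σ * ‖vecCoeff L f k‖) ^ 2 := by
  rw [sobolevTerm, besselSymbol_rpow, mul_pow, EuclideanSpace.norm_sq_eq]
  rfl

lemma sobolevTerm_nonneg (L σ : ℝ) (f : E3 → E3) (k : Fin 3 → ℤ) : 0 ≤ sobolevTerm L σ f k := by
  rw [sobolevTerm_eq]; positivity

lemma modeNorm_nonneg (L σ : ℝ) (f : E3 → E3) : 0 ≤ modeNorm L σ f := Real.sqrt_nonneg _

lemma sq_modeNorm (L σ : ℝ) (f : E3 → E3) : modeNorm L σ f ^ 2 = ∑' k, sobolevTerm L σ f k :=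
  Real.sq_sqrt (tsum_nonneg fun k => sobolevTerm_nonneg L σ f k)

lemma sobolevNorm_eq {L : ℝ} (hL : 0 < L) (σ : ℝ) (f : E3 → E3) :
    sobolevNorm L σ f = √((2 * L) ^ 3) * modeNorm L σ f := by
  rw [sobolevNorm, modeNorm, Real.sqrt_mul (by positivity)]

lemma seqNorm_vecCoeff {L σ : ℝ} {f : E3 → E3} (h : Summable (sobolevTerm L σ f)) :
    seqNorm L σ (fun k => ‖vecCoeff L f k‖ₑ) = ENNReal.ofReal (modeNorm L σ f) := by
  have h1 : ∀ k, (weight L k ^ σ * ‖vecCoeff L f k‖ₑ) ^ 2 = ENNReal.ofReal (sobolevTerm L σ f k) := by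
    intro k
    have := Real.rpow_nonneg (bracket_pos L k).le σ
    rw [sobolevTerm_eq, weight_rpow, ← ofReal_norm, ← ENNReal.ofReal_mul this,
      ENNReal.ofReal_pow (by positivity)]
  rw [seqNorm, ellTwo, tsum_congr h1, ← ENNReal.ofReal_tsum_of_nonneg (sobolevTerm_nonneg L σ f) h,
    ENNReal.ofReal_rpow_of_nonneg (tsum_nonneg (sobolevTerm_nonneg L σ f)) (by norm_num), modeNorm,
    Real.sqrt_eq_rpow]

lemma sobolevTerm_mono {L σ τ : ℝ} (h : σ ≤ τ) (f : E3 → E3) (k : Fin 3 → ℤ) :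
    sobolevTerm L σ f k ≤ sobolevTerm L τ f k := by
  rw [sobolevTerm, sobolevTerm]
  gcongr
  exact one_le_besselSymbol L k

lemma summable_sobolevTerm_mono {L σ τ : ℝ} (h : σ ≤ τ) {f : E3 → E3}
    (hf : Summable (sobolevTerm L τ f)) : Summable (sobolevTerm L σ f) :=
  .of_nonneg_of_le (sobolevTerm_nonneg L σ f) (sobolevTerm_mono h f) hf

lemma modeNorm_mono {L σ τ : ℝ} (h : σ ≤ τ) {f : E3 → E3} (hf : Summable (sobolevTerm L τ f)) :
    modeNorm L σ f ≤ modeNorm L τ f :=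
  Real.sqrt_le_sqrt ((summable_sobolevTerm_mono h hf).tsum_le_tsum (sobolevTerm_mono h f) hf)

lemma IsSolenoidalField.mono {L σ τ : ℝ} (h : σ ≤ τ) {f : E3 → E3} (hf : IsSolenoidalField L τ f) :
    IsSolenoidalField L σ f :=
  { hf with summable := summable_sobolevTerm_mono h hf.summable }

lemma torusFourierCoeff_add {L : ℝ} {f g : E3 → ℝ} (hf : IntegrableOn f (cube L))
    (hg : IntegrableOn g (cube L)) (k : Fin 3 → ℤ) :
    torusFourierCoeff L (fun x => f x + g x) k =
      torusFourierCoeff L f k + torusFourierCoeff L g k := by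
  simp only [torusFourierCoeff_eq, Complex.ofReal_add]
  exact complexFourierCoeff_add hf.ofReal hg.ofReal k

lemma torusFourierCoeff_const_mul (L : ℝ) (c : ℝ) (f : E3 → ℝ) (k : Fin 3 → ℤ) :
    torusFourierCoeff L (fun x => c * f x) k = c * torusFourierCoeff L f k := by
  simp only [torusFourierCoeff_eq, Complex.ofReal_mul]
  exact complexFourierCoeff_const_mul L c _ k

lemma torusFourierCoeff_congr_ae {L : ℝ} {f g : E3 → ℝ} (h : f =ᵐ[volume] g) (k : Fin 3 → ℤ) :
    torusFourierCoeff L f k = torusFourierCoeff L g k := by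
  simp only [torusFourierCoeff_eq]
  exact complexFourierCoeff_congr_ae (h.mono fun x hx => by simp only [hx]) k

lemma integrableOn_apply {L : ℝ} {f : E3 → E3} (hf : IntegrableOn f (cube L)) (i : Fin 3) :
    IntegrableOn (fun x => f x i) (cube L) :=
  (EuclideanSpace.proj (𝕜 := ℝ) (ι := Fin 3) i).integrable_comp hf

lemma vecCoeff_add {L : ℝ} {f g : E3 → E3} (hf : IntegrableOn f (cube L))
    (hg : IntegrableOn g (cube L)) (k : Fin 3 → ℤ) :
    vecCoeff L (fun x => f x + g x) k = vecCoeff L f k + vecCoeff L g k := by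
  ext i
  exact torusFourierCoeff_add (integrableOn_apply hf i) (integrableOn_apply hg i) k

lemma vecCoeff_const_smul (L : ℝ) (c : ℝ) (f : E3 → E3) (k : Fin 3 → ℤ) :
    vecCoeff L (fun x => c • f x) k = (c : ℂ) • vecCoeff L f k := by
  ext i
  exact torusFourierCoeff_const_mul L c (fun x => f x i) k

lemma vecCoeff_neg (L : ℝ) (f : E3 → E3) (k : Fin 3 → ℤ) :
    vecCoeff L (fun x => -f x) k = -vecCoeff L f k := by
  simpa using vecCoeff_const_smul L (-1) f k

lemma vecCoeff_sub {L : ℝ} {f g : E3 → E3} (hf : IntegrableOn f (cube L))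
    (hg : IntegrableOn g (cube L)) (k : Fin 3 → ℤ) :
    vecCoeff L (fun x => f x - g x) k = vecCoeff L f k - vecCoeff L g k := by
  simp only [sub_eq_add_neg]
  rw [← vecCoeff_neg]
  exact vecCoeff_add hf hg.neg k

lemma vecCoeff_congr_ae {L : ℝ} {f g : E3 → E3} (h : f =ᵐ[volume] g) (k : Fin 3 → ℤ) :
    vecCoeff L f k = vecCoeff L g k := by
  ext i
  exact torusFourierCoeff_congr_ae (h.mono fun x hx => by simp only [hx]) k

lemma sobolevTerm_le_of_norm_le {L σ : ℝ} {f g h : E3 → E3} {k : Fin 3 → ℤ}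
    (hk : ‖vecCoeff L f k‖ ≤ ‖vecCoeff L g k‖ + ‖vecCoeff L h k‖) :
    sobolevTerm L σ f k ≤ 2 * sobolevTerm L σ g k + 2 * sobolevTerm L σ h k := by
  simp only [sobolevTerm_eq, mul_pow]
  have h1 : ‖vecCoeff L f k‖ ^ 2 ≤ 2 * ‖vecCoeff L g k‖ ^ 2 + 2 * ‖vecCoeff L h k‖ ^ 2 := by
    have := pow_le_pow_left₀ (norm_nonneg _) hk 2
    nlinarith [sq_nonneg (‖vecCoeff L g k‖ - ‖vecCoeff L h k‖)]
  nlinarith [sq_nonneg (bracket L k ^ σ)]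

/-- The triangle inequality, up to a constant. -/
lemma modeNorm_le_of_norm_le {L σ : ℝ} {f g h : E3 → E3}
    (hk : ∀ k, ‖vecCoeff L f k‖ ≤ ‖vecCoeff L g k‖ + ‖vecCoeff L h k‖)
    (hg : Summable (sobolevTerm L σ g)) (hh : Summable (sobolevTerm L σ h)) :
    Summable (sobolevTerm L σ f) ∧
      modeNorm L σ f ≤ 2 * (modeNorm L σ g + modeNorm L σ h) := by
  have h1 := (hg.mul_left 2).add (hh.mul_left 2)
  have h2 : Summable (sobolevTerm L σ f) :=
    .of_nonneg_of_le (sobolevTerm_nonneg L σ f) (fun k => sobolevTerm_le_of_norm_le (hk k)) h1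
  refine ⟨h2, ?_⟩
  have h3 := h2.tsum_le_tsum (fun k => sobolevTerm_le_of_norm_le (hk k)) h1
  rw [(hg.mul_left 2).tsum_add (hh.mul_left 2), tsum_mul_left, tsum_mul_left, ← sq_modeNorm,
    ← sq_modeNorm, ← sq_modeNorm] at h3
  have := modeNorm_nonneg L σ g
  have := modeNorm_nonneg L σ h
  refine abs_le_of_sq_le_sq' (h3.trans ?_) (by positivity) |>.2
  nlinarith [mul_nonneg (modeNorm_nonneg L σ g) (modeNorm_nonneg L σ h)]

/-! ### Derivatives, the pressure and the advection term on the Fourier side -/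

lemma fderiv_apply_coord {f : E3 → E3} {x : E3} (hf : DifferentiableAt ℝ f x) (v : E3) (j : Fin 3) :
    fderiv ℝ (fun y => f y j) x v = (fderiv ℝ f x v) j := by
  have := ((EuclideanSpace.proj (𝕜 := ℝ) (ι := Fin 3) j).hasFDerivAt.comp x
    hf.hasFDerivAt).fderiv
  exact DFunLike.congr_fun this v

lemma divergence_sub {f g : E3 → E3} (hf : Differentiable ℝ f) (hg : Differentiable ℝ g) (x : E3) :
    divergence (fun x => f x - g x) x = divergence f x - divergence g x := by
  simp only [divergence, partialDeriv]
  rw [fderiv_fun_sub (hf x) (hg x)]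
  simp [Finset.sum_sub_distrib]

lemma IsSolenoidalField.sub {L σ : ℝ} {f g : E3 → E3} (hf : IsSolenoidalField L σ f)
    (hg : IsSolenoidalField L σ g) : IsSolenoidalField L σ (fun x => f x - g x) where
  periodic := hf.periodic.comp₂ hg.periodic fun a b => a - b
  contDiff := hf.contDiff.sub hg.contDiff
  divergence_eq_zero x := by
    rw [divergence_sub (hf.contDiff.differentiable one_ne_zero)
      (hg.contDiff.differentiable one_ne_zero), hf.divergence_eq_zero, hg.divergence_eq_zero,
      sub_zero]
  summable := (modeNorm_le_of_norm_le (fun k => by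
    rw [vecCoeff_sub (integrableOn_cube hf.contDiff.continuous)
      (integrableOn_cube hg.contDiff.continuous)]
    exact norm_sub_le _ _) hf.summable hg.summable).1

lemma contDiff_apply_coord {n : WithTop ℕ∞} {f : E3 → E3} (hf : ContDiff ℝ n f) (i : Fin 3) :
    ContDiff ℝ n (fun x => f x i) :=
  (EuclideanSpace.proj (𝕜 := ℝ) (ι := Fin 3) i).contDiff.comp hf

lemma torusFourierCoeff_fderiv {L : ℝ} (hL : 0 < L) {f : E3 → ℝ} (hf : IsPeriodic L f)
    (hc : ContDiff ℝ 1 f) (i : Fin 3) (k : Fin 3 → ℤ) :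
    torusFourierCoeff L (fun x => fderiv ℝ f x (EuclideanSpace.single i 1)) k =
      derivSymbol L k i * torusFourierCoeff L f k := by
  have h := complexFourierCoeff_fderiv hL (f := fun x => (f x : ℂ)) (hf.comp _)
    (Complex.ofRealCLM.contDiff.comp hc) i k
  rw [torusFourierCoeff_eq, torusFourierCoeff_eq, derivSymbol, ← h]
  congr 1
  ext x
  have := (Complex.ofRealCLM.hasFDerivAt.comp x
    (hc.differentiable one_ne_zero x).hasFDerivAt).fderiv
  exact (DFunLike.congr_fun this _).symm

lemma torusFourierCoeff_partialDeriv {L : ℝ} (hL : 0 < L) {f : E3 → E3} (hf : IsPeriodic L f)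
    (hc : ContDiff ℝ 1 f) (i j : Fin 3) (k : Fin 3 → ℤ) :
    torusFourierCoeff L (partialDeriv f i j) k = derivSymbol L k i * vecCoeff L f k j := by
  have := torusFourierCoeff_fderiv hL (hf.comp fun y => y j) (contDiff_apply_coord hc j) i k
  rw [vecCoeff, ← this]
  congr 1
  ext x
  exact (fderiv_apply_coord (hc.differentiable one_ne_zero x) _ j).symm

lemma continuous_partialDeriv {f : E3 → E3} (hc : ContDiff ℝ 1 f) (i j : Fin 3) :
    Continuous (partialDeriv f i j) := by
  have := hc.continuous_fderiv one_ne_zero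
  unfold partialDeriv
  fun_prop

lemma torusFourierCoeff_sum {L : ℝ} {ι : Type*} (s : Finset ι) (f : ι → E3 → ℝ)
    (hf : ∀ i ∈ s, Continuous (f i)) (k : Fin 3 → ℤ) :
    torusFourierCoeff L (fun x => ∑ i ∈ s, f i x) k = ∑ i ∈ s, torusFourierCoeff L (f i) k := by
  classical
  induction s using Finset.induction_on with
  | empty => simp [torusFourierCoeff]
  | insert a s ha ih =>
    simp only [Finset.sum_insert ha]
    rw [torusFourierCoeff_add (integrableOn_cube (hf a (Finset.mem_insert_self _ _)))
      (integrableOn_cube (continuous_finsetSum _ fun i hi => hf i (Finset.mem_insert_of_mem hi))),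
      ih fun i hi => hf i (Finset.mem_insert_of_mem hi)]

/-- The Fourier coefficients of a divergence-free field are orthogonal to the frequency. -/
lemma IsSolenoidalField.sum_derivSymbol_mul {L σ : ℝ} (hL : 0 < L) {f : E3 → E3}
    (hf : IsSolenoidalField L σ f) (k : Fin 3 → ℤ) :
    ∑ i, derivSymbol L k i * vecCoeff L f k i = 0 := by
  simp only [← torusFourierCoeff_partialDeriv hL hf.periodic hf.contDiff]
  rw [← torusFourierCoeff_sum _ _ fun i _ => continuous_partialDeriv hf.contDiff i i]
  have : (fun x => ∑ i, partialDeriv f i i x) = fun _ => 0 := funext hf.divergence_eq_zero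
  rw [this]
  simp [torusFourierCoeff]

lemma vecCoeff_neg_freq (L : ℝ) (f : E3 → E3) (k : Fin 3 → ℤ) (i : Fin 3) :
    vecCoeff L f (-k) i = (starRingEnd ℂ) (vecCoeff L f k i) :=
  torusFourierCoeff_neg L _ k

lemma gradient_apply_coord {p : E3 → ℝ} {x : E3} (i : Fin 3) :
    gradient p x i = fderiv ℝ p x (EuclideanSpace.single i 1) := by
  have h : inner ℝ (gradient p x) (EuclideanSpace.single i 1) = fderiv ℝ p x (EuclideanSpace.single i 1) := by
    rw [gradient, InnerProductSpace.toDual_symm_apply]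
  rw [← h, EuclideanSpace.inner_single_right]
  simp

lemma continuous_gradient {p : E3 → ℝ} (hp : ContDiff ℝ 1 p) : Continuous (gradient p) := by
  have := hp.continuous_fderiv one_ne_zero
  unfold gradient
  fun_prop

/-- Gradients are orthogonal to divergence-free fields, frequency by frequency: this eliminates the
pressure. -/
lemma IsSolenoidalField.inner_vecCoeff_gradient {L σ : ℝ} (hL : 0 < L) {f : E3 → E3}
    (hf : IsSolenoidalField L σ f) {p : E3 → ℝ} (hp : IsPeriodic L p) (hpc : ContDiff ℝ 1 p)
    (k : Fin 3 → ℤ) : inner ℂ (vecCoeff L f k) (vecCoeff L (gradient p) k) = 0 := by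
  have h1 : ∀ i, vecCoeff L (gradient p) k i = derivSymbol L k i * torusFourierCoeff L p k := by
    intro i
    rw [← torusFourierCoeff_fderiv hL hp hpc, vecCoeff]
    simp only [gradient_apply_coord]
  have h2 := congrArg (starRingEnd ℂ) (hf.sum_derivSymbol_mul hL k)
  simp only [map_sum, map_mul, derivSymbol, Complex.conj_ofReal, Complex.conj_I, map_zero] at h2
  simp only [PiLp.inner_apply, RCLike.inner_apply, h1, derivSymbol]
  calc _ = -torusFourierCoeff L p k * ∑ x, ↑(Real.pi / L * ↑(k x)) * -Complex.I *
        (starRingEnd ℂ) ((vecCoeff L f k).ofLp x) := by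
        rw [Finset.mul_sum]
        exact Finset.sum_congr rfl fun i _ => by ring
    _ = 0 := by rw [h2, mul_zero]

/-- The amplitude `∑ᵢ f̂ᵢ(k - j) i (π/L) jᵢ` with which the frequency `j` of `g` enters the
frequency `k` of `(f · ∇) g`. -/
def advectSymbol (L : ℝ) (f : E3 → E3) (k j : Fin 3 → ℤ) : ℂ :=
  ∑ i, vecCoeff L f (k - j) i * derivSymbol L j i

lemma norm_advectSymbol_le (L : ℝ) (f : E3 → E3) (k j : Fin 3 → ℤ) :
    ‖advectSymbol L f k j‖ ≤ ‖vecCoeff L f (k - j)‖ * bracket L j := by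
  have h1 : ‖(WithLp.toLp 2 (derivSymbol L j) : EuclideanSpace ℂ (Fin 3))‖ = ‖waveVector L j‖ := by
    simp [EuclideanSpace.norm_eq, derivSymbol, waveVector]
  have h2 := norm_inner_le_norm (𝕜 := ℂ)
    (WithLp.toLp 2 fun i => (starRingEnd ℂ) (derivSymbol L j i) : EuclideanSpace ℂ (Fin 3))
    (vecCoeff L f (k - j))
  have h3 : ‖(WithLp.toLp 2 fun i => (starRingEnd ℂ) (derivSymbol L j i) :
      EuclideanSpace ℂ (Fin 3))‖ = ‖waveVector L j‖ := by
    rw [← h1]; simp [EuclideanSpace.norm_eq]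
  simp only [PiLp.inner_apply, RCLike.inner_apply, Complex.conj_conj, h3] at h2
  rw [advectSymbol]
  refine h2.trans ?_
  rw [mul_comm]
  exact mul_le_mul_of_nonneg_left (norm_waveVector_le L j) (norm_nonneg _)

/-- The symmetry that makes the transport term conservative. -/
lemma IsSolenoidalField.advectSymbol_symm {L σ : ℝ} (hL : 0 < L) {f : E3 → E3}
    (hf : IsSolenoidalField L σ f) (k j : Fin 3 → ℤ) :
    advectSymbol L f j k = -(starRingEnd ℂ) (advectSymbol L f k j) := by
  have h1 := hf.sum_derivSymbol_mul hL (j - k)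
  have h2 : advectSymbol L f j k = ∑ i, vecCoeff L f (j - k) i * derivSymbol L j i := by
    rw [advectSymbol, ← sub_eq_zero, ← Finset.sum_sub_distrib]
    rw [← neg_eq_zero, ← Finset.sum_neg_distrib, ← h1]
    refine Finset.sum_congr rfl fun i _ => ?_
    simp only [derivSymbol, Pi.sub_apply]
    push_cast
    ring
  rw [h2, advectSymbol, map_sum, ← Finset.sum_neg_distrib]
  refine Finset.sum_congr rfl fun i _ => ?_
  rw [map_mul, ← vecCoeff_neg_freq, neg_sub, derivSymbol]
  simp

lemma advect_apply_coord (f g : E3 → E3) (x : E3) (m : Fin 3) :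
    advect f g x m = ∑ i, f x i * partialDeriv g i m x := by
  have h : f x = ∑ i, f x i • (EuclideanSpace.single i (1 : ℝ) : E3) := by
    ext j
    simp [Pi.single_apply]
  rw [advect]
  conv_lhs => rw [h, map_sum]
  simp [partialDeriv]

lemma continuous_advect {f g : E3 → E3} (hf : Continuous f) (hg : ContDiff ℝ 1 g) :
    Continuous (advect f g) := by
  have := hg.continuous_fderiv one_ne_zero
  unfold advect
  fun_prop

lemma summable_norm_vecCoeff {L σ : ℝ} (hL : 0 < L) (hσ : 3 / 2 < σ) {f : E3 → E3}
    (hf : Summable (sobolevTerm L σ f)) : Summable fun k => ‖vecCoeff L f k‖ := by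
  obtain ⟨C, hC, h⟩ := exists_tsum_weight_mul_le hL (σ := σ) (τ := 0) (by linarith)
  have h1 := h fun k => ‖vecCoeff L f k‖ₑ
  rw [seqNorm_vecCoeff hf] at h1
  simp only [ENNReal.rpow_zero, one_mul] at h1
  have h2 := ne_top_of_le_ne_top (ENNReal.mul_ne_top hC ENNReal.ofReal_ne_top) h1
  have := ENNReal.summable_toReal h2
  simpa using this

lemma hasSum_vecCoeff_advect {L σ : ℝ} (hL : 0 < L) (hσ : 3 / 2 < σ) {f g : E3 → E3}
    (hf : IsPeriodic L f) (hfc : Continuous f) (hfs : Summable (sobolevTerm L σ f))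
    (hg : IsPeriodic L g) (hgc : ContDiff ℝ 1 g) (k : Fin 3 → ℤ) :
    HasSum (fun j => advectSymbol L f k j • vecCoeff L g j) (vecCoeff L (advect f g) k) := by
  have key : ∀ m, HasSum (fun j => advectSymbol L f k j * vecCoeff L g j m)
      (vecCoeff L (advect f g) k m) := by
    intro m
    have h1 : vecCoeff L (advect f g) k m =
        ∑ i, torusFourierCoeff L (fun x => f x i * partialDeriv g i m x) k := by
      rw [← torusFourierCoeff_sum _ _ fun i _ => by
        have := continuous_partialDeriv hgc i m
        fun_prop]
      simp only [vecCoeff, advect_apply_coord]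
    have h2 : ∀ i ∈ Finset.univ, HasSum
        (fun j => vecCoeff L f (k - j) i * (derivSymbol L j i * vecCoeff L g j m))
        (torusFourierCoeff L (fun x => f x i * partialDeriv g i m x) k) := by
      intro i _
      have h3 : Summable (complexFourierCoeff L fun x => (f x i : ℂ)) := by
        refine Summable.of_norm_bounded (summable_norm_vecCoeff hL hσ hfs) fun l => ?_
        rw [← torusFourierCoeff_eq]
        exact PiLp.norm_apply_le (vecCoeff L f l) i
      have h4 := hasSum_complexFourierCoeff_mul hL (f := fun x => (f x i : ℂ))
        (g := fun x => (partialDeriv g i m x : ℂ)) (hf.comp fun y => (y i : ℂ))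
        (by fun_prop) h3
        (Complex.continuous_ofReal.comp (continuous_partialDeriv hgc i m)) k
      simp only [← torusFourierCoeff_eq, torusFourierCoeff_partialDeriv hL hg hgc] at h4
      rw [torusFourierCoeff_eq]
      simpa only [Complex.ofReal_mul] using! h4
    rw [h1]
    refine (hasSum_sum h2).congr_fun fun j => ?_
    rw [advectSymbol, Finset.sum_mul]
    exact Finset.sum_congr rfl fun i _ => by ring
  have h5 : HasSum (fun j => (WithLp.ofLp (advectSymbol L f k j • vecCoeff L g j) : Fin 3 → ℂ))
      (WithLp.ofLp (vecCoeff L (advect f g) k)) := Pi.hasSum.2 key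
  exact (PiLp.continuousLinearEquiv 2 ℂ (fun _ : Fin 3 => ℂ)).hasSum.1 h5

/-! ### Transport and product estimates -/

/-- The truncated `H^σ` pairing of two vector fields, over the frequencies in `S`. -/
def cutoffPairing (L σ n : ℝ) (S : Finset (Fin 3 → ℤ)) (z g : E3 → E3) : ℝ :=
  ∑ k ∈ S, cutoff σ n (bracket L k) ^ 2 * (inner ℂ (vecCoeff L z k) (vecCoeff L g k)).re

lemma enorm_cutoff_le {L σ n : ℝ} (hn : 0 < n) (k : Fin 3 → ℤ) :
    ‖cutoff σ n (bracket L k)‖ₑ ≤ weight L k ^ σ := by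
  rw [weight_rpow, Real.enorm_of_nonneg (cutoff_nonneg (bracket_pos L k).le)]
  exact ENNReal.ofReal_le_ofReal (cutoff_le hn (bracket_pos L k).le)

lemma enorm_bracket (L : ℝ) (k : Fin 3 → ℤ) : ‖bracket L k‖ₑ = weight L k :=
  Real.enorm_of_nonneg (bracket_pos L k).le

/-- Each interaction of two frequencies loses one derivative. -/
lemma enorm_re_mul_inner_le {L : ℝ} (z f g : E3 → E3) (k j : Fin 3 → ℤ) :
    ‖(advectSymbol L f k j * inner ℂ (vecCoeff L z k) (vecCoeff L g j)).re‖ₑ ≤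
      ‖vecCoeff L z k‖ₑ * (‖vecCoeff L f (k - j)‖ₑ * (weight L j * ‖vecCoeff L g j‖ₑ)) := by
  rw [← enorm_bracket]
  simp only [← ofReal_norm]
  rw [← ENNReal.ofReal_mul (norm_nonneg _), ← ENNReal.ofReal_mul (norm_nonneg _),
    ← ENNReal.ofReal_mul (norm_nonneg _)]
  refine ENNReal.ofReal_le_ofReal ((Complex.abs_re_le_norm _).trans ?_)
  rw [norm_mul, Real.norm_of_nonneg (bracket_pos L j).le]
  calc _ ≤ (‖vecCoeff L f (k - j)‖ * bracket L j) * (‖vecCoeff L z k‖ * ‖vecCoeff L g j‖) :=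
        mul_le_mul (norm_advectSymbol_le L f k j) (norm_inner_le_norm _ _) (norm_nonneg _)
          (mul_nonneg (norm_nonneg _) (bracket_pos L j).le)
    _ = _ := by ring

lemma hasSum_re_inner_advect {L σ : ℝ} (hL : 0 < L) (hσ : 3 / 2 < σ) {f g : E3 → E3}
    (hf : IsSolenoidalField L σ f) (hg : IsPeriodic L g) (hgc : ContDiff ℝ 1 g) (z : E3 → E3)
    (k : Fin 3 → ℤ) :
    HasSum (fun j => (advectSymbol L f k j * inner ℂ (vecCoeff L z k) (vecCoeff L g j)).re)
      (inner ℂ (vecCoeff L z k) (vecCoeff L (advect f g) k)).re := by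
  have h1 := hasSum_vecCoeff_advect hL hσ hf.periodic hf.contDiff.continuous hf.summable hg hgc k
  have h2 := (innerSL ℂ (vecCoeff L z k)).hasSum h1
  simp only [innerSL_apply_apply, inner_smul_right] at h2
  exact Complex.reCLM.hasSum h2

/-- The product estimate: pairing `(f · ∇) g` with `z` in `H^σ` costs one derivative on `g`. -/
lemma exists_abs_cutoffPairing_advect_le {L : ℝ} (hL : 0 < L) {σ : ℝ} (hσ : 3 / 2 < σ) :
    ∃ C : ℝ, 0 ≤ C ∧ ∀ (n : ℝ) (S : Finset (Fin 3 → ℤ)) (z f g : E3 → E3), 0 < n →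
      IsSolenoidalField L σ z → IsSolenoidalField L σ f → IsSolenoidalField L (σ + 1) g →
      |cutoffPairing L σ n S z (advect f g)| ≤
        C * (modeNorm L σ z * modeNorm L σ f * modeNorm L (σ + 1) g) := by
  obtain ⟨C, hC, hmain⟩ := exists_tsum_tsum_product_le hL hσ
  refine ⟨C.toReal, ENNReal.toReal_nonneg, fun n S z f g hn hz hf hg => ?_⟩
  have hnonneg : 0 ≤ modeNorm L σ z * modeNorm L σ f :=
    mul_nonneg (modeNorm_nonneg _ _ _) (modeNorm_nonneg _ _ _)
  rw [← Real.norm_eq_abs, ← ENNReal.ofReal_le_ofReal_iff (mul_nonneg ENNReal.toReal_nonneg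
    (mul_nonneg hnonneg (modeNorm_nonneg _ _ _))), ofReal_norm,
    ENNReal.ofReal_mul ENNReal.toReal_nonneg, ENNReal.ofReal_toReal hC,
    ENNReal.ofReal_mul hnonneg, ENNReal.ofReal_mul (modeNorm_nonneg _ _ _),
    ← seqNorm_vecCoeff hz.summable, ← seqNorm_vecCoeff hf.summable, ← seqNorm_vecCoeff hg.summable]
  have hshift : seqNorm L (σ + 1) (fun k => ‖vecCoeff L g k‖ₑ) =
      seqNorm L σ (fun k => weight L k * ‖vecCoeff L g k‖ₑ) := by
    rw [seqNorm, seqNorm]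
    congr 1
    ext k
    rw [ENNReal.rpow_add _ _ (weight_ne_zero L k) (weight_ne_top L k), ENNReal.rpow_one, mul_assoc]
  rw [hshift]
  refine le_trans ?_ (hmain _ _ _)
  refine (enorm_sum_le _ _).trans ?_
  refine le_trans (Finset.sum_le_sum fun k _ => ?_) (ENNReal.sum_le_tsum S)
  rw [enorm_mul, enorm_pow, ← (hasSum_re_inner_advect hL hσ hf hg.periodic hg.contDiff z k).tsum_eq]
  calc _ ≤ (weight L k ^ σ) ^ 2 * ∑' j, ‖vecCoeff L z k‖ₑ * (‖vecCoeff L f (k - j)‖ₑ *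
        (weight L j * ‖vecCoeff L g j‖ₑ)) := by
        refine mul_le_mul' (pow_le_pow_left' (enorm_cutoff_le hn k) 2) ?_
        exact enorm_tsum_le_tsum_enorm.trans
          (ENNReal.tsum_le_tsum fun j => enorm_re_mul_inner_le z f g k j)
    _ = _ := by
        rw [← ENNReal.tsum_mul_left]
        exact tsum_congr fun j => by ring

/-- The transport estimate: the derivative falling on `z` costs nothing, since the top-order part of
the form is antisymmetric. -/
lemma exists_abs_cutoffPairing_transport_le {L : ℝ} (hL : 0 < L) {σ : ℝ} (hσ : 5 / 2 < σ) :
    ∃ C : ℝ, 0 ≤ C ∧ ∀ (n : ℝ) (S : Finset (Fin 3 → ℤ)) (z f : E3 → E3), 0 < n →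
      (∀ k ∉ S, n ≤ bracket L k) →
      IsSolenoidalField L σ z → IsSolenoidalField L σ f →
      |cutoffPairing L σ n S z (advect f z)| ≤
        C * (modeNorm L σ z * modeNorm L σ f * modeNorm L σ z) := by
  have hB0 : 0 ≤ (σ + 1) * 2 ^ (σ - 1) := by
    have : 0 ≤ σ + 1 := by linarith
    positivity
  obtain ⟨C, hC, hmain⟩ := exists_tsum_tsum_commutator_le hL hσ
    (ENNReal.ofReal ((σ + 1) * 2 ^ (σ - 1))) ENNReal.ofReal_ne_top
  refine ⟨C.toReal, ENNReal.toReal_nonneg, fun n S z f hn hS hz hf => ?_⟩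
  have hnonneg : 0 ≤ modeNorm L σ z * modeNorm L σ f :=
    mul_nonneg (modeNorm_nonneg _ _ _) (modeNorm_nonneg _ _ _)
  rw [← Real.norm_eq_abs, ← ENNReal.ofReal_le_ofReal_iff (mul_nonneg ENNReal.toReal_nonneg
    (mul_nonneg hnonneg (modeNorm_nonneg _ _ _))), ofReal_norm,
    ENNReal.ofReal_mul ENNReal.toReal_nonneg, ENNReal.ofReal_toReal hC,
    ENNReal.ofReal_mul hnonneg, ENNReal.ofReal_mul (modeNorm_nonneg _ _ _),
    ← seqNorm_vecCoeff hz.summable, ← seqNorm_vecCoeff hf.summable]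
  set a : (Fin 3 → ℤ) → ℝ := fun k => cutoff σ n (bracket L k) with ha
  set κ : (Fin 3 → ℤ) → (Fin 3 → ℤ) → ℝ := fun k j =>
    (advectSymbol L f k j * inner ℂ (vecCoeff L z k) (vecCoeff L z j)).re with hκ
  have hanti : ∀ k j, κ j k = -κ k j := by
    intro k j
    simp only [hκ]
    rw [hf.advectSymbol_symm hL k j, ← inner_conj_symm, neg_mul, ← map_mul, Complex.neg_re,
      Complex.conj_re]
  have hzero : ∑ k ∈ S, ∑ j ∈ S, a k * a j * κ k j = 0 := by
    have h1 : ∑ k ∈ S, ∑ j ∈ S, a k * a j * κ k j = -∑ k ∈ S, ∑ j ∈ S, a k * a j * κ k j := by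
      conv_lhs => rw [Finset.sum_comm]
      simp only [← Finset.sum_neg_distrib]
      refine Finset.sum_congr rfl fun k _ => Finset.sum_congr rfl fun j _ => ?_
      rw [hanti]; ring
    linarith
  have hsum : ∀ k, HasSum (fun j => a k * (a k - a j) * κ k j)
      (a k ^ 2 * (inner ℂ (vecCoeff L z k) (vecCoeff L (advect f z) k)).re -
        ∑ j ∈ S, a k * a j * κ k j) := by
    intro k
    have h1 := (hasSum_re_inner_advect hL (by linarith) hf hz.periodic hz.contDiff z k).mul_left
      (a k ^ 2)
    have h2 : HasSum (fun j => a k * a j * κ k j) (∑ j ∈ S, a k * a j * κ k j) :=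
      hasSum_sum_of_ne_finset_zero fun j hj => by
        simp only [ha, cutoff_eq_zero hn (hS j hj), mul_zero, zero_mul]
    exact (h1.sub h2).congr_fun fun j => by ring
  have hrepr : cutoffPairing L σ n S z (advect f z) =
      ∑ k ∈ S, ∑' j, a k * (a k - a j) * κ k j := by
    rw [Finset.sum_congr rfl fun k _ => (hsum k).tsum_eq, Finset.sum_sub_distrib, hzero, sub_zero]
    rfl
  rw [hrepr]
  refine le_trans ?_ (hmain _ _ _ (fun k j => ‖a k - a j‖ₑ) fun k j => ?_)
  · refine (enorm_sum_le _ _).trans ?_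
    refine le_trans (Finset.sum_le_sum fun k _ => ?_) (ENNReal.sum_le_tsum S)
    refine enorm_tsum_le_tsum_enorm.trans (ENNReal.tsum_le_tsum fun j => ?_)
    rw [enorm_mul, enorm_mul]
    calc _ ≤ weight L k ^ σ * ‖a k - a j‖ₑ * (‖vecCoeff L z k‖ₑ *
          (‖vecCoeff L f (k - j)‖ₑ * (weight L j * ‖vecCoeff L z j‖ₑ))) :=
          mul_le_mul' (mul_le_mul' (enorm_cutoff_le hn k) le_rfl) (enorm_re_mul_inner_le z f z k j)
      _ = _ := by ring
  · have h1 := abs_cutoff_sub_mul_le (σ := σ) (by linarith) hn (bracket_pos L k) (bracket_pos L j)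
      (bracket_pos L (k - j)) (abs_bracket_sub_le L k j)
    have h2 := (Real.rpow_pos_of_pos (bracket_pos L j) σ).le
    have h3 := (Real.rpow_pos_of_pos (bracket_pos L (k - j)) σ).le
    have h4 := (bracket_pos L j).le
    have h5 := (bracket_pos L (k - j)).le
    rw [weight_rpow, weight_rpow, weight, weight, ← ENNReal.ofReal_mul h5, ← ENNReal.ofReal_mul h3,
      ← ENNReal.ofReal_add (by positivity) (by positivity), ← ENNReal.ofReal_mul hB0,
      ← ofReal_norm, ← ENNReal.ofReal_mul (norm_nonneg _)]
    exact ENNReal.ofReal_le_ofReal h1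

/-! ### The maximum of the curl -/

/-- The Sobolev bound for first derivatives, from the absolute convergence of Fourier series. -/
lemma exists_norm_curl_le {L : ℝ} (hL : 0 < L) {σ : ℝ} (hσ : 5 / 2 < σ) :
    ∃ C : ℝ, 0 ≤ C ∧ ∀ f : E3 → E3, IsSolenoidalField L σ f → ∀ x,
      ‖curl f x‖ ≤ C * modeNorm L σ f := by
  obtain ⟨K, hK, hmain⟩ := exists_tsum_weight_mul_le hL (σ := σ) (τ := 1) (by linarith)
  refine ⟨6 * K.toReal, by positivity, fun f hf x => ?_⟩
  have h1 := hmain fun k => ‖vecCoeff L f k‖ₑ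
  rw [seqNorm_vecCoeff hf.summable] at h1
  have e1 : ∀ k, weight L k ^ (1 : ℝ) * ‖vecCoeff L f k‖ₑ =
      ENNReal.ofReal (bracket L k * ‖vecCoeff L f k‖) := fun k => by
    rw [ENNReal.rpow_one, weight, ENNReal.ofReal_mul (bracket_pos L k).le, ofReal_norm]
  simp only [e1] at h1
  have h0 : ∀ k, 0 ≤ bracket L k * ‖vecCoeff L f k‖ := fun k =>
    mul_nonneg (bracket_pos L k).le (norm_nonneg _)
  have hfin : K * ENNReal.ofReal (modeNorm L σ f) ≠ ∞ := ENNReal.mul_ne_top hK ENNReal.ofReal_ne_top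
  have hsum : Summable fun k => bracket L k * ‖vecCoeff L f k‖ := by
    have := ENNReal.summable_toReal (ne_top_of_le_ne_top hfin h1)
    simpa [h0] using this
  have hle : ∑' k, bracket L k * ‖vecCoeff L f k‖ ≤ K.toReal * modeNorm L σ f := by
    rw [← ENNReal.ofReal_tsum_of_nonneg h0 hsum] at h1
    have := ENNReal.toReal_mono hfin h1
    rwa [ENNReal.toReal_ofReal (tsum_nonneg h0), ENNReal.toReal_mul,
      ENNReal.toReal_ofReal (modeNorm_nonneg _ _ _)] at this
  have hpd : ∀ i j, |partialDeriv f i j x| ≤ K.toReal * modeNorm L σ f := by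
    intro i j
    have hb : ∀ k, ‖complexFourierCoeff L (fun x => (partialDeriv f i j x : ℂ)) k‖ ≤
        bracket L k * ‖vecCoeff L f k‖ := by
      intro k
      rw [← torusFourierCoeff_eq, torusFourierCoeff_partialDeriv hL hf.periodic hf.contDiff, norm_mul]
      refine mul_le_mul ?_ (PiLp.norm_apply_le _ j) (norm_nonneg _) (bracket_pos L k).le
      refine le_trans ?_ (norm_waveVector_le L k)
      refine le_trans (le_of_eq ?_) (PiLp.norm_apply_le (waveVector L k) i)
      simp [derivSymbol, waveVector]
    have hs : Summable (complexFourierCoeff L (fun x => (partialDeriv f i j x : ℂ))) :=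
      .of_norm_bounded hsum hb
    have hper : IsPeriodic L (fun x => (partialDeriv f i j x : ℂ)) :=
      hf.periodic.fderiv_periodic.comp fun T => ((T (EuclideanSpace.single i 1) j : ℝ) : ℂ)
    have h2 := (hper.hasSum_torusChar hL
      (Complex.continuous_ofReal.comp (continuous_partialDeriv hf.contDiff i j)) hs x).tsum_eq
    rw [← Real.norm_eq_abs, ← Complex.norm_real, ← h2]
    refine (tsum_of_norm_bounded hsum.hasSum fun k => ?_).trans hle
    rw [norm_mul, norm_torusChar, mul_one]
    exact hb k
  have hcurl : ∀ y : E3, ‖y‖ ≤ |y 0| + |y 1| + |y 2| := by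
    intro y
    rw [EuclideanSpace.norm_eq]
    refine Real.sqrt_le_iff.2 ⟨by positivity, ?_⟩
    simp only [Fin.sum_univ_three, Real.norm_eq_abs]
    nlinarith [abs_nonneg (y 0), abs_nonneg (y 1), abs_nonneg (y 2),
      mul_nonneg (abs_nonneg (y 0)) (abs_nonneg (y 1)),
      mul_nonneg (abs_nonneg (y 0)) (abs_nonneg (y 2)),
      mul_nonneg (abs_nonneg (y 1)) (abs_nonneg (y 2))]
  refine (hcurl _).trans ?_
  have d : ∀ i j k l, |partialDeriv f i j x - partialDeriv f k l x| ≤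
      2 * (K.toReal * modeNorm L σ f) := fun i j k l => by
    refine (abs_sub _ _).trans ?_
    linarith [hpd i j, hpd k l]
  have d0 := d 1 2 2 1
  have d1 := d 2 0 0 2
  have d2 := d 0 1 1 0
  simp only [curl]
  simp
  linarith

/-! ### The energy inequality -/

section TimeDependent

variable {L T : ℝ} {z : ℝ → E3 → E3}

lemma contDiff_slice {n : WithTop ℕ∞}
    (hz : ContDiffOn ℝ n (fun w : ℝ × E3 => z w.1 w.2) (Icc 0 T ×ˢ univ))
    {t : ℝ} (ht : t ∈ Icc 0 T) : ContDiff ℝ n (z t) := by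
  rw [← contDiffOn_univ]
  exact hz.comp (contDiffOn_const.prodMk contDiffOn_id) fun x _ => ⟨ht, mem_univ _⟩

/-- A field that is `C¹` up to the boundary in time is Lipschitz in time, uniformly over a period. -/
lemma exists_lipschitzOnWith_time (hT : 0 < T)
    (hz : ContDiffOn ℝ 1 (fun w : ℝ × E3 => z w.1 w.2) (Icc 0 T ×ˢ univ)) :
    ∃ K : NNReal, ∀ x ∈ cube L, LipschitzOnWith K (fun t => z t x) (Icc 0 T) := by
  obtain ⟨R, hR⟩ := (isBounded_cube L).subset_closedBall (0 : E3)
  have hu : UniqueDiffOn ℝ (Icc 0 T ×ˢ (univ : Set E3)) :=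
    (uniqueDiffOn_Icc hT).prod uniqueDiffOn_univ
  have hsub : Icc 0 T ×ˢ Metric.closedBall (0 : E3) R ⊆ Icc 0 T ×ˢ univ :=
    prod_mono le_rfl (subset_univ _)
  obtain ⟨M, hM⟩ := (isCompact_Icc.prod (isCompact_closedBall (0 : E3) R)).exists_bound_of_continuousOn
    ((hz.continuousOn_fderivWithin hu le_rfl).mono hsub)
  have hlip : LipschitzOnWith M.toNNReal (fun w : ℝ × E3 => z w.1 w.2)
      (Icc 0 T ×ˢ Metric.closedBall (0 : E3) R) := by
    refine Convex.lipschitzOnWith_of_nnnorm_hasFDerivWithin_le (𝕜 := ℝ)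
      (f' := fderivWithin ℝ (fun w : ℝ × E3 => z w.1 w.2) (Icc 0 T ×ˢ univ))
      (fun w hw => ((hz.differentiableOn one_ne_zero w (hsub hw)).hasFDerivWithinAt).mono hsub)
      (fun w hw => ?_) ((convex_Icc _ _).prod (convex_closedBall _ _))
    rw [← NNReal.coe_le_coe, coe_nnnorm]
    exact (hM w hw).trans (Real.le_coe_toNNReal M)
  refine ⟨M.toNNReal, fun x hx => ?_⟩
  refine LipschitzOnWith.of_dist_le_mul fun t ht t' ht' => ?_
  have := hlip.dist_le_mul (t, x) ⟨ht, hR hx⟩ (t', x) ⟨ht', hR hx⟩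
  simpa [Prod.dist_eq] using this

lemma lipschitzOnWith_mul_torusChar {K : NNReal} {x : E3} {s : Set ℝ}
    (hK : LipschitzOnWith K (fun t => z t x) s) (i : Fin 3) (k : Fin 3 → ℤ) :
    LipschitzOnWith K (fun t => ((z t x i : ℝ) : ℂ) * torusChar L (-k) x) s := by
  refine LipschitzOnWith.of_dist_le_mul fun t ht t' ht' => ?_
  rw [dist_eq_norm, ← sub_mul, norm_mul, norm_torusChar, mul_one, ← Complex.ofReal_sub,
    Complex.norm_real]
  refine le_trans ?_ (hK.dist_le_mul t ht t' ht')
  rw [dist_eq_norm]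
  exact PiLp.norm_apply_le (z t x - z t' x) i

lemma continuous_coord_mul_torusChar {f : E3 → E3} (hf : Continuous f) (i : Fin 3)
    (k : Fin 3 → ℤ) : Continuous fun x => ((f x i : ℝ) : ℂ) * torusChar L k x := by
  have := continuous_torusChar L k
  fun_prop

lemma continuousOn_vecCoeff (hT : 0 < T)
    (hz : ContDiffOn ℝ 1 (fun w : ℝ × E3 => z w.1 w.2) (Icc 0 T ×ˢ univ)) (k : Fin 3 → ℤ) :
    ContinuousOn (fun t => vecCoeff L (z t) k) (Icc 0 T) := by
  obtain ⟨K, hK⟩ := exists_lipschitzOnWith_time (L := L) hT hz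
  obtain ⟨R, hR⟩ := (isBounded_cube L).subset_closedBall (0 : E3)
  obtain ⟨M, hM⟩ := (isCompact_Icc.prod (isCompact_closedBall (0 : E3) R)).exists_bound_of_continuousOn
    (hz.continuousOn.mono (prod_mono le_rfl (subset_univ (Metric.closedBall (0 : E3) R))))
  have hcoord : ∀ i, ContinuousOn (fun t => vecCoeff L (z t) k i) (Icc 0 T) := by
    intro i
    simp only [vecCoeff, torusFourierCoeff_eq, complexFourierCoeff]
    refine continuousOn_const.mul (continuousOn_of_dominated (bound := fun _ => M)
      (fun t ht => (continuous_coord_mul_torusChar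
        (contDiff_slice hz ht).continuous i (-k)).aestronglyMeasurable)
      (fun t ht => ?_) (integrable_const _) ?_)
    · refine ae_restrict_of_forall_mem (measurableSet_cube L) fun x hx => ?_
      rw [norm_mul, norm_torusChar, mul_one, Complex.norm_real]
      exact (PiLp.norm_apply_le (z t x) i).trans (hM (t, x) ⟨ht, hR hx⟩)
    · exact ae_restrict_of_forall_mem (measurableSet_cube L) fun x hx =>
        (lipschitzOnWith_mul_torusChar (hK x hx) i k).continuousOn
  exact (PiLp.continuous_toLp 2 (fun _ : Fin 3 => ℂ)).comp_continuousOn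
    (continuousOn_pi.2 hcoord)

/-- Differentiation of Fourier coefficients under the integral sign. -/
lemma hasDerivAt_vecCoeff
    (hz : ContDiffOn ℝ 1 (fun w : ℝ × E3 => z w.1 w.2) (Icc 0 T ×ˢ univ)) {t : ℝ}
    (ht : t ∈ Ioo 0 T) {g : E3 → E3} (hg : Continuous g)
    (hd : ∀ x, HasDerivWithinAt (fun τ => z τ x) (g x) (Icc 0 T) t) (k : Fin 3 → ℤ) :
    HasDerivAt (fun τ => vecCoeff L (z τ) k) (vecCoeff L g k) t := by
  have hT : 0 < T := ht.1.trans ht.2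
  have hnhds : Icc 0 T ∈ nhds t := Icc_mem_nhds ht.1 ht.2
  obtain ⟨K, hK⟩ := exists_lipschitzOnWith_time (L := L) hT hz
  have hcoord : ∀ i, HasDerivAt (fun τ => vecCoeff L (z τ) k i) (vecCoeff L g k i) t := by
    intro i
    simp only [vecCoeff, torusFourierCoeff_eq, complexFourierCoeff]
    refine HasDerivAt.const_mul _ (hasDerivAt_integral_of_dominated_loc_of_lip
      (bound := fun _ => (K : ℝ)) hnhds ?_ ?_ ?_ ?_ (integrable_const _) ?_).2
    · filter_upwards [hnhds] with τ hτ
      exact (continuous_coord_mul_torusChar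
        (contDiff_slice hz hτ).continuous i (-k)).aestronglyMeasurable
    · exact integrableOn_cube (continuous_coord_mul_torusChar
        (contDiff_slice hz (Ioo_subset_Icc_self ht)).continuous i (-k))
    · exact (continuous_coord_mul_torusChar hg i (-k)).aestronglyMeasurable
    · refine ae_restrict_of_forall_mem (measurableSet_cube L) fun x hx => ?_
      simpa using lipschitzOnWith_mul_torusChar (hK x hx) i k
    · refine Filter.Eventually.of_forall fun x => ?_
      have h1 : HasDerivAt (fun τ => z τ x) (g x) t := (hd x).hasDerivAt hnhds
      have h2 : HasDerivAt (fun τ => z τ x i) (g x i) t :=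
        (EuclideanSpace.proj (𝕜 := ℝ) (ι := Fin 3) i).hasFDerivAt.comp_hasDerivAt t h1
      exact h2.ofReal_comp.mul_const _
  exact (PiLp.continuousLinearEquiv 2 ℂ (fun _ : Fin 3 => ℂ)).symm.hasFDerivAt.restrictScalars ℝ
    |>.comp_hasDerivAt t (hasDerivAt_pi.2 hcoord)

lemma hasDerivAt_cutoffPairing
    (hz : ContDiffOn ℝ 1 (fun w : ℝ × E3 => z w.1 w.2) (Icc 0 T ×ˢ univ)) {t : ℝ}
    (ht : t ∈ Ioo 0 T) {g : E3 → E3} (hg : Continuous g)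
    (hd : ∀ x, HasDerivWithinAt (fun τ => z τ x) (g x) (Icc 0 T) t) (σ n : ℝ)
    (S : Finset (Fin 3 → ℤ)) :
    HasDerivAt (fun τ => cutoffPairing L σ n S (z τ) (z τ))
      (2 * cutoffPairing L σ n S (z t) g) t := by
  unfold cutoffPairing
  rw [Finset.mul_sum]
  refine HasDerivAt.fun_sum fun k _ => ?_
  have h1 := hasDerivAt_vecCoeff (L := L) hz ht hg hd k
  have h2 := Complex.reCLM.hasFDerivAt.comp_hasDerivAt t (h1.inner ℂ h1)
  have h3 := h2.const_mul (cutoff σ n (bracket L k) ^ 2)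
  convert! h3 using 1
  simp only [Complex.reCLM_apply, Complex.add_re]
  rw [← inner_conj_symm (vecCoeff L g k), Complex.conj_re]
  ring

lemma cutoffPairing_self (L σ n : ℝ) (S : Finset (Fin 3 → ℤ)) (f : E3 → E3) :
    cutoffPairing L σ n S f f = ∑ k ∈ S, (cutoff σ n (bracket L k) * ‖vecCoeff L f k‖) ^ 2 := by
  refine Finset.sum_congr rfl fun k _ => ?_
  rw [mul_pow, inner_self_eq_norm_sq_to_K]
  norm_cast

lemma cutoffPairing_self_le {σ n : ℝ} (hn : 0 < n) (S : Finset (Fin 3 → ℤ)) {f : E3 → E3}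
    (hf : Summable (sobolevTerm L σ f)) : cutoffPairing L σ n S f f ≤ modeNorm L σ f ^ 2 := by
  rw [cutoffPairing_self, sq_modeNorm]
  refine le_trans (Finset.sum_le_sum fun k _ => ?_)
    (hf.sum_le_tsum S fun k _ => sobolevTerm_nonneg L σ f k)
  rw [sobolevTerm_eq]
  have := cutoff_nonneg (σ := σ) (n := n) (bracket_pos L k).le
  gcongr
  exact cutoff_le hn (bracket_pos L k).le

/-- The `H^σ` norm is recovered by removing the cutoff. -/
lemma sq_modeNorm_le_of_cutoffPairing_le {σ c : ℝ} {f : E3 → E3}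
    (hf : Summable (sobolevTerm L σ f)) {S : ℝ → Finset (Fin 3 → ℤ)}
    (hS : ∀ n, ∀ k ∉ S n, n ≤ bracket L k)
    (h : ∀ n, 0 < n → cutoffPairing L σ n (S n) f f ≤ c) : modeNorm L σ f ^ 2 ≤ c := by
  rw [sq_modeNorm]
  refine hf.tsum_le_of_sum_le fun F => ?_
  have hlim : Filter.Tendsto
      (fun n : ℝ => ∑ k ∈ F, (cutoff σ n (bracket L k) * ‖vecCoeff L f k‖) ^ 2) Filter.atTop
      (nhds (∑ k ∈ F, sobolevTerm L σ f k)) := by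
    refine tendsto_finsetSum _ fun k _ => ?_
    rw [sobolevTerm_eq]
    refine Filter.Tendsto.pow (Filter.Tendsto.mul_const _ ?_) 2
    have h1 : Filter.Tendsto (fun n : ℝ => max 0 (1 - bracket L k / n)) Filter.atTop
        (nhds (max 0 (1 - 0))) :=
      tendsto_const_nhds.max
        (tendsto_const_nhds.sub (tendsto_const_nhds.div_atTop Filter.tendsto_id))
    simpa [cutoff] using h1.const_mul (bracket L k ^ σ)
  refine le_of_tendsto hlim ?_
  filter_upwards [Filter.eventually_gt_atTop 0] with n hn
  refine le_trans ?_ (h n hn)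
  rw [cutoffPairing_self]
  classical
  have e : ∑ k ∈ F ∪ S n, (cutoff σ n (bracket L k) * ‖vecCoeff L f k‖) ^ 2 =
      ∑ k ∈ S n, (cutoff σ n (bracket L k) * ‖vecCoeff L f k‖) ^ 2 := by
    refine (Finset.sum_subset Finset.subset_union_right fun k _ hk => ?_).symm
    rw [cutoff_eq_zero hn (hS n k hk), zero_mul, zero_pow two_ne_zero]
  rw [← e]
  exact Finset.sum_le_sum_of_subset_of_nonneg Finset.subset_union_left fun _ _ _ => sq_nonneg _

/-- The integrated energy inequality: a bound on the truncated energy production, uniform in the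
truncation, controls the growth of the `H^σ` norm. -/
lemma sq_modeNorm_le_add_integral {σ : ℝ} (hL : 0 < L)
    (hz : ContDiffOn ℝ 1 (fun w : ℝ × E3 => z w.1 w.2) (Icc 0 T ×ˢ univ))
    (hs : ∀ t ∈ Icc 0 T, Summable (sobolevTerm L σ (z t))) {g : ℝ → E3 → E3}
    (hg : ∀ t ∈ Icc 0 T, Continuous (g t))
    (hd : ∀ t ∈ Icc 0 T, ∀ x, HasDerivWithinAt (fun τ => z τ x) (g t x) (Icc 0 T) t)
    {φ : ℝ → ℝ} (hφ : IntegrableOn φ (Icc 0 T))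
    (h : ∀ t ∈ Icc 0 T, ∀ (n : ℝ) (S : Finset (Fin 3 → ℤ)), 0 < n → (∀ k ∉ S, n ≤ bracket L k) →
      2 * cutoffPairing L σ n S (z t) (g t) ≤ φ t)
    {t : ℝ} (ht : t ∈ Icc 0 T) :
    modeNorm L σ (z t) ^ 2 ≤ modeNorm L σ (z 0) ^ 2 + ∫ τ in (0 : ℝ)..t, φ τ := by
  rcases ht.1.eq_or_lt with h0 | h0
  · simp [← h0]
  have hT : 0 < T := h0.trans_le ht.2
  let S : ℝ → Finset (Fin 3 → ℤ) := fun n => (finite_setOf_bracket_lt hL n).toFinset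
  have hS : ∀ n, ∀ k ∉ S n, n ≤ bracket L k := fun n k hk => by
    simpa [S] using hk
  refine sq_modeNorm_le_of_cutoffPairing_le (hs t ht) hS fun n hn => ?_
  have hsub : Icc 0 t ⊆ Icc 0 T := Icc_subset_Icc_right ht.2
  have hcont : ContinuousOn (fun τ => cutoffPairing L σ n (S n) (z τ) (z τ)) (Icc 0 t) := by
    simp only [cutoffPairing_self]
    exact continuousOn_finsetSum _ fun k _ =>
      ((continuousOn_const.mul (continuousOn_vecCoeff hT hz k).norm).pow 2).mono hsub
  have key := intervalIntegral.sub_le_integral_of_hasDeriv_right_of_le h0.le hcont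
    (fun τ hτ => (hasDerivAt_cutoffPairing (L := L) hz (Ioo_subset_Ioo_right ht.2 hτ)
      (hg τ (hsub (Ioo_subset_Icc_self hτ))) (hd τ (hsub (Ioo_subset_Icc_self hτ))) σ n
      (S n)).hasDerivWithinAt)
    (hφ.mono_set hsub) fun τ hτ => h τ (hsub (Ioo_subset_Icc_self hτ)) n (S n) hn (hS n)
  have h1 := cutoffPairing_self_le hn (S n) (hs 0 (hsub (left_mem_Icc.2 h0.le)))
  linarith

lemma aestronglyMeasurable_modeNorm {σ : ℝ} (hT : 0 < T)
    (hz : ContDiffOn ℝ 1 (fun w : ℝ × E3 => z w.1 w.2) (Icc 0 T ×ˢ univ))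
    (hs : ∀ t ∈ Icc 0 T, Summable (sobolevTerm L σ (z t))) :
    AEStronglyMeasurable (fun t => modeNorm L σ (z t)) (volume.restrict (Icc 0 T)) := by
  have h1 : AEMeasurable (fun t => (∑' k, ENNReal.ofReal (sobolevTerm L σ (z t) k)).toReal)
      (volume.restrict (Icc 0 T)) := by
    refine (AEMeasurable.tsum fun k => ?_).ennreal_toReal
    simp only [sobolevTerm_eq]
    exact (((continuousOn_const.mul (continuousOn_vecCoeff hT hz k).norm).pow 2).aemeasurable
      measurableSet_Icc).ennreal_ofReal
  refine (h1.sqrt.congr ?_).aestronglyMeasurable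
  refine ae_restrict_of_forall_mem measurableSet_Icc fun t ht => ?_
  dsimp only
  rw [← ENNReal.ofReal_tsum_of_nonneg (sobolevTerm_nonneg L σ _) (hs t ht),
    ENNReal.toReal_ofReal (tsum_nonneg (sobolevTerm_nonneg L σ _)), modeNorm]

end TimeDependent

/-! ### Integral inequalities of Grönwall type -/

/-- `f` is measurable and bounded on `[0, T]`. -/
def IsBoundedMeasurable (T : ℝ) (f : ℝ → ℝ) : Prop :=
  AEStronglyMeasurable f (volume.restrict (Icc 0 T)) ∧ ∃ M : ℝ, ∀ t ∈ Icc 0 T, |f t| ≤ M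

namespace IsBoundedMeasurable

variable {T : ℝ} {f g : ℝ → ℝ}

lemma const (T c : ℝ) : IsBoundedMeasurable T fun _ => c :=
  ⟨aestronglyMeasurable_const, |c|, fun _ _ => le_rfl⟩

lemma add (hf : IsBoundedMeasurable T f) (hg : IsBoundedMeasurable T g) :
    IsBoundedMeasurable T fun t => f t + g t := by
  obtain ⟨hf, M, hM⟩ := hf
  obtain ⟨hg, N, hN⟩ := hg
  exact ⟨hf.add hg, M + N, fun t ht => (abs_add_le _ _).trans (add_le_add (hM t ht) (hN t ht))⟩

lemma mul (hf : IsBoundedMeasurable T f) (hg : IsBoundedMeasurable T g) :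
    IsBoundedMeasurable T fun t => f t * g t := by
  obtain ⟨hf, M, hM⟩ := hf
  obtain ⟨hg, N, hN⟩ := hg
  refine ⟨hf.mul hg, M * N, fun t ht => ?_⟩
  rw [abs_mul]
  exact mul_le_mul (hM t ht) (hN t ht) (abs_nonneg _) ((abs_nonneg _).trans (hM t ht))

lemma const_mul (c : ℝ) (hf : IsBoundedMeasurable T f) : IsBoundedMeasurable T fun t => c * f t :=
  (const T c).mul hf

lemma sq (hf : IsBoundedMeasurable T f) : IsBoundedMeasurable T fun t => f t ^ 2 := by
  simpa only [pow_two] using hf.mul hf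

lemma mono {T' : ℝ} (h : T' ≤ T) (hf : IsBoundedMeasurable T f) : IsBoundedMeasurable T' f :=
  ⟨hf.1.mono_measure (Measure.restrict_mono (Icc_subset_Icc_right h) le_rfl),
    hf.2.imp fun _ hM t ht => hM t (Icc_subset_Icc_right h ht)⟩

lemma integrableOn (hf : IsBoundedMeasurable T f) : IntegrableOn f (Icc 0 T) := by
  obtain ⟨hf, M, hM⟩ := hf
  exact Integrable.of_bound hf M
    (ae_restrict_of_forall_mem measurableSet_Icc hM)

lemma intervalIntegrable (hf : IsBoundedMeasurable T f) {a b : ℝ} (ha : a ∈ Icc 0 T)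
    (hb : b ∈ Icc 0 T) : IntervalIntegrable f volume a b :=
  (hf.integrableOn.mono_set (uIcc_subset_Icc ha hb)).intervalIntegrable

/-- The integrating factor `exp (-∫₀ᵗ f)` is absolutely continuous. -/
lemma absolutelyContinuousOnInterval_exp (hf : IsBoundedMeasurable T f)
    (h0 : ∀ t ∈ Icc 0 T, 0 ≤ f t) {t : ℝ} (ht : t ∈ Icc 0 T) :
    AbsolutelyContinuousOnInterval (fun τ => Real.exp (-∫ s in (0 : ℝ)..τ, f s)) 0 t := by
  obtain ⟨M, hM⟩ := hf.2
  have hz : (0 : ℝ) ∈ Icc 0 T := left_mem_Icc.2 (ht.1.trans ht.2)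
  have hsub : uIcc 0 t ⊆ Icc 0 T := uIcc_subset_Icc hz ht
  have hpos : ∀ a ∈ Icc 0 T, 0 ≤ ∫ s in (0 : ℝ)..a, f s := fun a ha =>
    intervalIntegral.integral_nonneg ha.1 fun s hs => h0 s ⟨hs.1, hs.2.trans ha.2⟩
  have hexp : ∀ a b : ℝ, 0 ≤ a → a ≤ b → |Real.exp (-a) - Real.exp (-b)| ≤ |b - a| := by
    intro a b ha hab
    rw [abs_of_nonneg (sub_nonneg.2 (Real.exp_le_exp.2 (by linarith))),
      abs_of_nonneg (sub_nonneg.2 hab)]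
    have h1 : Real.exp (-a) ≤ 1 := Real.exp_le_one_iff.2 (by linarith)
    have h2 : Real.exp (-b) = Real.exp (-a) * Real.exp (-(b - a)) := by
      rw [← Real.exp_add]; congr 1; ring
    have h3 := Real.one_sub_le_exp_neg (b - a)
    have h4 := Real.exp_pos (-a)
    rw [h2]
    nlinarith
  refine LipschitzOnWith.absolutelyContinuousOnInterval (K := M.toNNReal) ?_
  refine LipschitzOnWith.of_dist_le_mul fun a ha b hb => ?_
  have ha' := hsub ha
  have hb' := hsub hb
  have h1 : |(∫ s in (0 : ℝ)..b, f s) - ∫ s in (0 : ℝ)..a, f s| ≤ M * |b - a| := by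
    rw [intervalIntegral.integral_interval_sub_left (hf.intervalIntegrable hz hb')
      (hf.intervalIntegrable hz ha')]
    exact intervalIntegral.norm_integral_le_of_norm_le_const (f := f) fun s hs =>
      hM s (uIcc_subset_Icc ha' hb' (uIoc_subset_uIcc hs))
  have h2 : M * |b - a| ≤ M.toNNReal * dist a b := by
    rw [Real.dist_eq, abs_sub_comm a b]
    exact mul_le_mul_of_nonneg_right (Real.le_coe_toNNReal M) (abs_nonneg _)
  refine le_trans ?_ (h1.trans h2)
  rw [Real.dist_eq]
  rcases le_total (∫ s in (0 : ℝ)..a, f s) (∫ s in (0 : ℝ)..b, f s) with hab | hab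
  · exact hexp _ _ (hpos a ha') hab
  · rw [abs_sub_comm, abs_sub_comm (∫ s in (0 : ℝ)..b, f s)]
    exact hexp _ _ (hpos b hb') hab

lemma ae_hasDerivAt_exp (hf : IsBoundedMeasurable T f) {t : ℝ} (ht : t ∈ Icc 0 T) :
    ∀ᵐ τ, τ ∈ uIcc 0 t → HasDerivAt (fun τ => Real.exp (-∫ s in (0 : ℝ)..τ, f s))
      (-(f τ * Real.exp (-∫ s in (0 : ℝ)..τ, f s))) τ := by
  have hz : (0 : ℝ) ∈ Icc 0 T := left_mem_Icc.2 (ht.1.trans ht.2)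
  filter_upwards [(hf.intervalIntegrable hz ht).ae_hasDerivAt_integral] with τ h1 h2
  rw [mul_comm, ← mul_neg]
  exact (h1 h2 0 left_mem_uIcc).fun_neg.exp

end IsBoundedMeasurable

variable {T : ℝ}

/-- Grönwall's inequality in integral form, for bounded measurable functions. -/
lemma le_mul_exp_of_le_add_integral {q β : ℝ → ℝ} {q₀ : ℝ} (hq : IsBoundedMeasurable T q)
    (hβ : IsBoundedMeasurable T β) (hβ0 : ∀ t ∈ Icc 0 T, 0 ≤ β t)
    (h : ∀ t ∈ Icc 0 T, q t ≤ q₀ + ∫ s in (0 : ℝ)..t, β s * q s) {t : ℝ} (ht : t ∈ Icc 0 T) :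
    q t ≤ q₀ * Real.exp (∫ s in (0 : ℝ)..t, β s) := by
  have hz : (0 : ℝ) ∈ Icc 0 T := left_mem_Icc.2 (ht.1.trans ht.2)
  have hsub : uIcc 0 t ⊆ Icc 0 T := uIcc_subset_Icc hz ht
  set Q : ℝ → ℝ := fun τ => q₀ + ∫ s in (0 : ℝ)..τ, β s * q s with hQ
  set e : ℝ → ℝ := fun τ => Real.exp (-∫ s in (0 : ℝ)..τ, β s) with he
  have hint := (hβ.mul hq).intervalIntegrable hz ht
  have hQac : AbsolutelyContinuousOnInterval Q 0 t := by
    have h1 : AbsolutelyContinuousOnInterval (fun _ : ℝ => q₀) 0 t :=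
      (LipschitzWith.const q₀).lipschitzOnWith.absolutelyContinuousOnInterval
    exact h1.add (hint.absolutelyContinuousOnInterval_intervalIntegral left_mem_uIcc)
  have heac := hβ.absolutelyContinuousOnInterval_exp hβ0 ht
  have key := heac.integral_deriv_mul_eq_sub hQac
  have hle : ∫ x in (0 : ℝ)..t, deriv e x * Q x + e x * deriv Q x ≤ 0 := by
    rw [← neg_nonneg, ← intervalIntegral.integral_neg]
    refine intervalIntegral.integral_nonneg_of_ae_restrict ht.1 ?_
    rw [Filter.EventuallyLE, ae_restrict_iff' measurableSet_Icc]
    filter_upwards [hβ.ae_hasDerivAt_exp ht, hint.ae_hasDerivAt_integral] with τ h1 h2 h3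
    have h3' : τ ∈ uIcc 0 t := by rwa [uIcc_of_le ht.1]
    have h4 : HasDerivAt Q (β τ * q τ) τ := (h2 h3' 0 left_mem_uIcc).const_add q₀
    rw [(h1 h3').deriv, h4.deriv]
    have h5 := h τ (hsub h3')
    have h6 := mul_nonneg (hβ0 τ (hsub h3')) (Real.exp_pos (-∫ s in (0 : ℝ)..τ, β s)).le
    have h7 := mul_le_mul_of_nonneg_left h5 h6
    simp only [Pi.zero_apply, he]
    simp only [hQ]
    linarith
  rw [key] at hle
  have e0 : e 0 * Q 0 = q₀ := by simp [he, hQ]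
  have h8 : e t * Q t ≤ q₀ := by linarith
  refine (h t ht).trans ?_
  have h9 : Real.exp (∫ s in (0 : ℝ)..t, β s) * e t = 1 := by
    rw [he, ← Real.exp_add]; simp
  calc Q t = (Real.exp (∫ s in (0 : ℝ)..t, β s) * e t) * Q t := by rw [h9, one_mul]
    _ = (e t * Q t) * Real.exp (∫ s in (0 : ℝ)..t, β s) := by ring
    _ ≤ q₀ * Real.exp (∫ s in (0 : ℝ)..t, β s) := by gcongr

/-- A quadratic Grönwall inequality: solutions of `y' ≤ C (b + y) y` with small initial values stay
comparable to those of `y' ≤ C b y`. -/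
lemma le_of_sq_le_add_integral {y b : ℝ → ℝ} {y₀ C B : ℝ} (hC : 0 ≤ C) (hy₀ : 0 ≤ y₀)
    (hy : IsBoundedMeasurable T y) (hb : IsBoundedMeasurable T b)
    (hy0 : ∀ t ∈ Icc 0 T, 0 ≤ y t) (hb0 : ∀ t ∈ Icc 0 T, 0 ≤ b t)
    (hB : ∀ t ∈ Icc 0 T, ∫ s in (0 : ℝ)..t, b s ≤ B)
    (h : ∀ t ∈ Icc 0 T, y t ^ 2 ≤ y₀ ^ 2 + ∫ s in (0 : ℝ)..t, 2 * C * (b s + y s) * y s ^ 2)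
    (hsmall : C * (y₀ * Real.exp (C * B)) * T ≤ 1 / 2) {t : ℝ} (ht : t ∈ Icc 0 T) :
    y t ≤ 2 * (y₀ * Real.exp (C * B)) := by
  set m := y₀ * Real.exp (C * B) with hm
  have hm0 : 0 ≤ m := by positivity
  have hz : (0 : ℝ) ∈ Icc 0 T := left_mem_Icc.2 (ht.1.trans ht.2)
  have hCy := hy.const_mul C
  have hCy0 : ∀ t ∈ Icc 0 T, 0 ≤ C * y t := fun t ht => mul_nonneg hC (hy0 t ht)
  -- the linear inequality, in which `y` is regarded as a part of the coefficient
  have h1 : ∀ t ∈ Icc 0 T, y t ≤ m * Real.exp (∫ s in (0 : ℝ)..t, C * y s) := by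
    intro t ht
    have h2 := le_mul_exp_of_le_add_integral hy.sq ((hb.add hy).const_mul (2 * C))
      (fun t ht => mul_nonneg (by positivity) (add_nonneg (hb0 t ht) (hy0 t ht))) h ht
    have h3 : y₀ ^ 2 * Real.exp (∫ s in (0 : ℝ)..t, 2 * C * (b s + y s)) =
        (y₀ * Real.exp (C * ∫ s in (0 : ℝ)..t, b s) *
          Real.exp (∫ s in (0 : ℝ)..t, C * y s)) ^ 2 := by
      rw [intervalIntegral.integral_const_mul, intervalIntegral.integral_const_mul,
        intervalIntegral.integral_add (hb.intervalIntegrable hz ht) (hy.intervalIntegrable hz ht),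
        mul_pow, mul_pow, ← Real.exp_nat_mul, ← Real.exp_nat_mul, mul_assoc (y₀ ^ 2),
        ← Real.exp_add]
      congr 2; push_cast; ring
    rw [h3] at h2
    refine (abs_le_of_sq_le_sq' h2 (by positivity)).2.trans ?_
    rw [hm]
    gcongr
    exact hB t ht
  -- hence `(exp (-C ∫ y))' ≥ -C m`
  set e : ℝ → ℝ := fun τ => Real.exp (-∫ s in (0 : ℝ)..τ, C * y s) with he
  have hac := hCy.absolutelyContinuousOnInterval_exp hCy0 ht
  have h4 : -(C * m) * t ≤ e t - e 0 := by
    rw [← hac.integral_deriv_eq_sub]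
    have h5 : ∫ _ in (0 : ℝ)..t, -(C * m) = -(C * m) * t := by
      rw [intervalIntegral.integral_const]; simp; ring
    rw [← h5]
    refine intervalIntegral.integral_mono_ae_restrict ht.1 intervalIntegrable_const
      hac.intervalIntegrable_deriv ?_
    rw [Filter.EventuallyLE, ae_restrict_iff' measurableSet_Icc]
    filter_upwards [hCy.ae_hasDerivAt_exp ht] with τ h6 h7
    have h7' : τ ∈ uIcc 0 t := by rwa [uIcc_of_le ht.1]
    rw [(h6 h7').deriv]
    have h8 := mul_le_mul_of_nonneg_right (h1 τ ⟨h7.1, h7.2.trans ht.2⟩)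
      (Real.exp_pos (-∫ s in (0 : ℝ)..τ, C * y s)).le
    rw [mul_assoc, ← Real.exp_add, add_neg_cancel, Real.exp_zero, mul_one] at h8
    have := mul_le_mul_of_nonneg_left h8 hC
    linarith
  have e0 : e 0 = 1 := by simp [he]
  have h9 : (1 : ℝ) / 2 ≤ e t := by
    have : C * m * t ≤ C * m * T := mul_le_mul_of_nonneg_left ht.2 (by positivity)
    linarith
  have h10 : Real.exp (∫ s in (0 : ℝ)..t, C * y s) * e t = 1 := by
    rw [he, ← Real.exp_add]; simp
  have h11 : Real.exp (∫ s in (0 : ℝ)..t, C * y s) ≤ 2 := by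
    nlinarith [Real.exp_pos (∫ s in (0 : ℝ)..t, C * y s)]
  calc y t ≤ m * Real.exp (∫ s in (0 : ℝ)..t, C * y s) := h1 t ht
    _ ≤ m * 2 := by gcongr
    _ = 2 * m := by ring

/-- A Grönwall inequality with a constant source: solutions of `y' ≤ C (b y + r)` with zero initial
value. -/
lemma le_of_sq_le_integral {y b : ℝ → ℝ} {C B r T' : ℝ} (hC : 0 ≤ C) (hr : 0 ≤ r)
    (hT' : 0 < T') (hTT' : T ≤ T')
    (hy : IsBoundedMeasurable T y) (hb : IsBoundedMeasurable T b)
    (hb0 : ∀ t ∈ Icc 0 T, 0 ≤ b t)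
    (hB : ∀ t ∈ Icc 0 T, ∫ s in (0 : ℝ)..t, b s ≤ B)
    (h : ∀ t ∈ Icc 0 T, y t ^ 2 ≤ ∫ s in (0 : ℝ)..t, 2 * C * (b s * y s ^ 2 + y s * r))
    {t : ℝ} (ht : t ∈ Icc 0 T) :
    y t ≤ √C * Real.exp (C / 2) * r * T' * Real.exp (C * B) := by
  have hz : (0 : ℝ) ∈ Icc 0 T := left_mem_Icc.2 (ht.1.trans ht.2)
  have hβ := (hb.const_mul (2 * C)).add (IsBoundedMeasurable.const T (C / T'))
  have h1 : ∀ t ∈ Icc 0 T, y t ^ 2 ≤ C * r ^ 2 * T' ^ 2 +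
      ∫ s in (0 : ℝ)..t, (2 * C * b s + C / T') * y s ^ 2 := by
    intro t ht
    have hc : ∫ _ in (0 : ℝ)..t, C * r ^ 2 * T' = C * r ^ 2 * T' * t := by
      rw [intervalIntegral.integral_const]; simp; ring
    have h2 : ∫ s in (0 : ℝ)..t, 2 * C * (b s * y s ^ 2 + y s * r) ≤
        ∫ s in (0 : ℝ)..t, (C * r ^ 2 * T' + (2 * C * b s + C / T') * y s ^ 2) := by
      refine intervalIntegral.integral_mono_on ht.1
        ((((hb.mul hy.sq).add (hy.mul (.const T r))).const_mul (2 * C)).intervalIntegrable hz ht)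
        (((IsBoundedMeasurable.const T (C * r ^ 2 * T')).add
          (hβ.mul hy.sq)).intervalIntegrable hz ht) fun s _ => ?_
      -- Young's inequality, weighted by the length of the time interval
      have h3 : 2 * (y s * r) ≤ r ^ 2 * T' + y s ^ 2 / T' := by
        have h4 : r ^ 2 * T' + y s ^ 2 / T' - 2 * (y s * r) = (r * T' - y s) ^ 2 / T' := by
          field_simp; ring
        have := div_nonneg (sq_nonneg (r * T' - y s)) hT'.le
        linarith
      have h5 := mul_le_mul_of_nonneg_left h3 hC
      have e : C / T' * y s ^ 2 = C * (y s ^ 2 / T') := by ring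
      rw [add_mul, e]
      linarith
    rw [intervalIntegral.integral_add intervalIntegrable_const
      ((hβ.mul hy.sq).intervalIntegrable hz ht), hc] at h2
    refine (h t ht).trans (h2.trans ?_)
    have : C * r ^ 2 * T' * t ≤ C * r ^ 2 * T' * T' :=
      mul_le_mul_of_nonneg_left (ht.2.trans hTT') (by positivity)
    linarith
  have h2 := le_mul_exp_of_le_add_integral hy.sq hβ
    (fun t ht => add_nonneg (mul_nonneg (by positivity) (hb0 t ht)) (by positivity)) h1 ht
  have h3 : ∫ s in (0 : ℝ)..t, (2 * C * b s + C / T') ≤ 2 * (C * B) + C := by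
    rw [intervalIntegral.integral_add ((hb.const_mul (2 * C)).intervalIntegrable hz ht)
      intervalIntegrable_const, intervalIntegral.integral_const_mul,
      intervalIntegral.integral_const, smul_eq_mul, sub_zero]
    have h4 : t * (C / T') ≤ C := by
      rw [← mul_div_assoc, div_le_iff₀ hT', mul_comm]
      exact mul_le_mul_of_nonneg_left (ht.2.trans hTT') hC
    have h5 := mul_le_mul_of_nonneg_left (hB t ht) hC
    linarith
  have hpow : C * r ^ 2 * T' ^ 2 * Real.exp (2 * (C * B) + C) =
      (√C * Real.exp (C / 2) * r * T' * Real.exp (C * B)) ^ 2 := by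
    simp only [mul_pow, Real.sq_sqrt hC, ← Real.exp_nat_mul]
    rw [Real.exp_add]
    push_cast
    rw [mul_div_cancel₀ C two_ne_zero]
    ring
  refine (abs_le_of_sq_le_sq' ?_ (by positivity)).2
  rw [← hpow]
  exact h2.trans (mul_le_mul_of_nonneg_left (Real.exp_le_exp.2 h3) (by positivity))

/-! ### Flows and their differences -/

lemma sqrt_side_pos {L : ℝ} (hL : 0 < L) : 0 < √((2 * L) ^ 3) := by positivity

namespace IsSolenoidalFlow

variable {L σ T : ℝ} {u v : ℝ → E3 → E3}

lemma field (hu : IsSolenoidalFlow L σ T u) {t : ℝ} (ht : t ∈ Icc 0 T) :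
    IsSolenoidalField L σ (u t) where
  periodic := (hu.memSobolev t ht).1
  contDiff := contDiff_slice hu.contDiffOn ht
  divergence_eq_zero := hu.divergence_eq_zero t ht
  summable := (hu.memSobolev t ht).2.2

lemma mono {T' : ℝ} (h : T' ≤ T) (hu : IsSolenoidalFlow L σ T u) : IsSolenoidalFlow L σ T' u :=
  have hsub : Icc 0 T' ⊆ Icc 0 T := Icc_subset_Icc_right h
  { contDiffOn := hu.contDiffOn.mono (prod_mono hsub le_rfl)
    divergence_eq_zero := fun t ht => hu.divergence_eq_zero t (hsub ht)
    memSobolev := fun t ht => hu.memSobolev t (hsub ht)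
    bounded := hu.bounded.imp fun _ hM t ht => hM t (hsub ht) }

lemma of_le {τ : ℝ} (hL : 0 < L) (h : τ ≤ σ) (hu : IsSolenoidalFlow L σ T u) :
    IsSolenoidalFlow L τ T u where
  contDiffOn := hu.contDiffOn
  divergence_eq_zero := hu.divergence_eq_zero
  memSobolev t ht := ⟨(hu.memSobolev t ht).1, (hu.memSobolev t ht).2.1,
    summable_sobolevTerm_mono h (hu.memSobolev t ht).2.2⟩
  bounded := by
    obtain ⟨M, hM⟩ := hu.bounded
    refine ⟨M, fun t ht => le_trans ?_ (hM t ht)⟩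
    rw [sobolevNorm_eq hL, sobolevNorm_eq hL]
    exact mul_le_mul_of_nonneg_left (modeNorm_mono h (hu.field ht).summable) (Real.sqrt_nonneg _)

lemma sub (hL : 0 < L) (hu : IsSolenoidalFlow L σ T u) (hv : IsSolenoidalFlow L σ T v) :
    IsSolenoidalFlow L σ T (fun t x => u t x - v t x) where
  contDiffOn := hu.contDiffOn.sub hv.contDiffOn
  divergence_eq_zero t ht := ((hu.field ht).sub (hv.field ht)).divergence_eq_zero
  memSobolev t ht := ⟨((hu.field ht).sub (hv.field ht)).periodic,
    (hu.memSobolev t ht).2.1.sub (hv.memSobolev t ht).2.1, ((hu.field ht).sub (hv.field ht)).summable⟩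
  bounded := by
    obtain ⟨M, hM⟩ := hu.bounded
    obtain ⟨N, hN⟩ := hv.bounded
    refine ⟨2 * (M + N), fun t ht => ?_⟩
    have h1 := hM t ht
    have h2 := hN t ht
    rw [sobolevNorm_eq hL] at h1 h2 ⊢
    have h3 := (modeNorm_le_of_norm_le (L := L) (σ := σ) (f := fun x => u t x - v t x) (fun k => by
      rw [vecCoeff_sub (integrableOn_cube (hu.field ht).contDiff.continuous)
        (integrableOn_cube (hv.field ht).contDiff.continuous)]
      exact norm_sub_le _ _) (hu.field ht).summable (hv.field ht).summable).2
    have h4 := mul_le_mul_of_nonneg_left h3 (Real.sqrt_nonneg ((2 * L) ^ 3))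
    linarith

lemma isBoundedMeasurable (hL : 0 < L) (hT : 0 < T) (hu : IsSolenoidalFlow L σ T u) :
    IsBoundedMeasurable T fun t => modeNorm L σ (u t) := by
  obtain ⟨M, hM⟩ := hu.bounded
  refine ⟨aestronglyMeasurable_modeNorm hT hu.contDiffOn fun t ht => (hu.field ht).summable,
    M / √((2 * L) ^ 3), fun t ht => ?_⟩
  rw [abs_of_nonneg (modeNorm_nonneg _ _ _), le_div_iff₀ (sqrt_side_pos hL), mul_comm,
    ← sobolevNorm_eq hL]
  exact hM t ht

end IsSolenoidalFlow

lemma modeNorm_le_of_sub {L σ : ℝ} {f g : E3 → E3} (hf : IsSolenoidalField L σ f)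
    (hg : IsSolenoidalField L σ g) :
    modeNorm L σ f ≤ 2 * (modeNorm L σ (fun x => f x - g x) + modeNorm L σ g) :=
  (modeNorm_le_of_norm_le (fun k => by
    rw [vecCoeff_sub (integrableOn_cube hf.contDiff.continuous)
      (integrableOn_cube hg.contDiff.continuous)]
    simpa using norm_add_le (vecCoeff L f k - vecCoeff L g k) (vecCoeff L g k))
    (hf.sub hg).summable hg.summable).2

lemma advect_sub_right {f g h : E3 → E3} (hg : Differentiable ℝ g) (hh : Differentiable ℝ h)
    (x : E3) : advect f (fun y => g y - h y) x = advect f g x - advect f h x := by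
  simp only [advect]
  rw [fderiv_fun_sub (hg x) (hh x), sub_apply]

lemma advect_sub_left (f g h : E3 → E3) (x : E3) :
    advect (fun y => f y - g y) h x = advect f h x - advect g h x := by
  simp only [advect, map_sub]

lemma gradient_fun_sub {p q : E3 → ℝ} (hp : Differentiable ℝ p) (hq : Differentiable ℝ q) (x : E3) :
    gradient (fun y => p y - q y) x = gradient p x - gradient q x := by
  simp only [gradient]
  rw [fderiv_fun_sub (hp x) (hq x), map_sub]

lemma IsPressure.sub {L T : ℝ} {p q : ℝ → E3 → ℝ} (hp : IsPressure L T p) (hq : IsPressure L T q) :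
    IsPressure L T fun t x => p t x - q t x := fun t ht =>
  ⟨(hp t ht).1.sub (hq t ht).1, (hp t ht).2.comp₂ (hq t ht).2 fun a b => a - b⟩

lemma IsPressure.mono {L T T' : ℝ} (h : T' ≤ T) {p : ℝ → E3 → ℝ} (hp : IsPressure L T p) :
    IsPressure L T' p := fun t ht => hp t (Icc_subset_Icc_right h ht)

lemma cutoffPairing_add {L σ n : ℝ} (S : Finset (Fin 3 → ℤ)) (z : E3 → E3) {f g : E3 → E3}
    (hf : Continuous f) (hg : Continuous g) :
    cutoffPairing L σ n S z (fun x => f x + g x) =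
      cutoffPairing L σ n S z f + cutoffPairing L σ n S z g := by
  simp only [cutoffPairing, ← Finset.sum_add_distrib]
  refine Finset.sum_congr rfl fun k _ => ?_
  rw [vecCoeff_add (integrableOn_cube hf) (integrableOn_cube hg), inner_add_right, Complex.add_re,
    mul_add]

/-- The pressure does not contribute to the energy balance. -/
lemma cutoffPairing_neg_add_gradient {L σ n : ℝ} (hL : 0 < L) (S : Finset (Fin 3 → ℤ))
    {z f : E3 → E3} (hz : IsSolenoidalField L σ z) (hf : Continuous f) {p : E3 → ℝ}
    (hp : IsPeriodic L p) (hpc : ContDiff ℝ 1 p) :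
    cutoffPairing L σ n S z (fun x => -(f x + gradient p x)) = -cutoffPairing L σ n S z f := by
  simp only [cutoffPairing, ← Finset.sum_neg_distrib]
  refine Finset.sum_congr rfl fun k _ => ?_
  rw [vecCoeff_neg, vecCoeff_add (integrableOn_cube hf) (integrableOn_cube (continuous_gradient hpc)),
    inner_neg_right, inner_add_right, hz.inner_vecCoeff_gradient hL hp hpc, add_zero,
    Complex.neg_re, mul_neg]

lemma curl_sub {f g : E3 → E3} (hf : Differentiable ℝ f) (hg : Differentiable ℝ g) (x : E3) :
    curl (fun y => f y - g y) x = curl f x - curl g x := by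
  have h : ∀ i j, partialDeriv (fun y => f y - g y) i j x =
      partialDeriv f i j x - partialDeriv g i j x := fun i j => by
    simp only [partialDeriv]
    rw [fderiv_fun_sub (hf x) (hg x)]
    rfl
  ext i
  fin_cases i <;> simp [curl, h] <;> ring

/-! ### The energy estimates for the perturbation and for the linearization error -/

/-- The energy inequality for `∂ₜ w + u · ∇w + w · ∇ū + ∇q = 0` with `u = ū + w`. -/
lemma exists_perturbation_estimate {L : ℝ} (hL : 0 < L) {σ : ℝ} (hσ : 5 / 2 < σ) :
    ∃ C : ℝ, 0 ≤ C ∧ ∀ (T : ℝ) (u ubar : ℝ → E3 → E3) (q : ℝ → E3 → ℝ), 0 < T →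
      IsSolenoidalFlow L σ T u → IsSolenoidalFlow L (σ + 1) T ubar → IsPressure L T q →
      (∀ t ∈ Icc 0 T, ∀ x, HasDerivWithinAt (fun τ => u τ x - ubar τ x)
        (-(advect (u t) (fun y => u t y - ubar t y) x +
          advect (fun y => u t y - ubar t y) (ubar t) x + gradient (q t) x)) (Icc 0 T) t) →
      ∀ t ∈ Icc 0 T, modeNorm L σ (fun x => u t x - ubar t x) ^ 2 ≤
        modeNorm L σ (fun x => u 0 x - ubar 0 x) ^ 2 +
          ∫ τ in (0 : ℝ)..t, 2 * C * (modeNorm L (σ + 1) (ubar τ) +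
            modeNorm L σ (fun x => u τ x - ubar τ x)) *
              modeNorm L σ (fun x => u τ x - ubar τ x) ^ 2 := by
  obtain ⟨C₁, hC₁, htrans⟩ := exists_abs_cutoffPairing_transport_le hL hσ
  obtain ⟨C₂, hC₂, hprod⟩ := exists_abs_cutoffPairing_advect_le hL (σ := σ) (by linarith)
  refine ⟨2 * C₁ + C₂, by positivity, fun T u ubar q hT hu hubar hq hd t ht => ?_⟩
  have hubar' : IsSolenoidalFlow L σ T ubar := hubar.of_le hL (by linarith)
  have hw := hu.sub hL hubar'
  have hy := hw.isBoundedMeasurable hL hT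
  have hb := hubar.isBoundedMeasurable hL hT
  have hc₁ : ∀ t ∈ Icc 0 T, Continuous (advect (u t) (fun y => u t y - ubar t y)) := fun t ht =>
    continuous_advect (hu.field ht).contDiff.continuous (hw.field ht).contDiff
  have hc₂ : ∀ t ∈ Icc 0 T, Continuous (advect (fun y => u t y - ubar t y) (ubar t)) := fun t ht =>
    continuous_advect (hw.field ht).contDiff.continuous (hubar.field ht).contDiff
  have hc : ∀ t ∈ Icc 0 T, Continuous fun x => advect (u t) (fun y => u t y - ubar t y) x +
      advect (fun y => u t y - ubar t y) (ubar t) x := fun t ht => (hc₁ t ht).add (hc₂ t ht)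
  refine sq_modeNorm_le_add_integral hL hw.contDiffOn (fun t ht => (hw.field ht).summable)
    (g := fun t x => -(advect (u t) (fun y => u t y - ubar t y) x +
      advect (fun y => u t y - ubar t y) (ubar t) x + gradient (q t) x))
    (fun t ht => ((hc t ht).add (continuous_gradient (hq t ht).1)).neg) hd
    (((hb.add hy).const_mul _).mul hy.sq).integrableOn (fun t ht n S hn hS => ?_) ht
  rw [cutoffPairing_neg_add_gradient hL S (hw.field ht) (hc t ht) (hq t ht).2
    (hq t ht).1, cutoffPairing_add S _ (hc₁ t ht) (hc₂ t ht)]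
  have h1 := htrans n S _ _ hn hS (hw.field ht) (hu.field ht)
  have h2 := hprod n S _ _ _ hn (hw.field ht) (hw.field ht) (hubar.field ht)
  have h3 := modeNorm_le_of_sub (hu.field ht) (hubar'.field ht)
  have h4 := modeNorm_mono (σ := σ) (by linarith) (hubar.field ht).summable
  set y := modeNorm L σ (fun x => u t x - ubar t x)
  set b := modeNorm L (σ + 1) (ubar t)
  have hy0 : 0 ≤ y := modeNorm_nonneg _ _ _
  have hb0 : 0 ≤ b := modeNorm_nonneg _ _ _
  have h5 : C₁ * (y * modeNorm L σ (u t) * y) ≤ C₁ * (y * (2 * (y + b)) * y) := by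
    gcongr
    linarith
  have h6 := neg_le_of_abs_le h1
  have h7 := neg_le_of_abs_le h2
  have h8 : 0 ≤ C₂ * (y * y * y) := by positivity
  nlinarith

/-- The energy inequality for `∂ₜ v + ū · ∇v + v · ∇ū + w · ∇w + ∇q = 0`, in which `w · ∇w` is
a source term. -/
lemma exists_linearization_estimate {L : ℝ} (hL : 0 < L) {σ : ℝ} (hσ : 5 / 2 < σ) :
    ∃ C : ℝ, 0 ≤ C ∧ ∀ (T Y : ℝ) (ubar w v : ℝ → E3 → E3) (q : ℝ → E3 → ℝ), 0 < T →
      IsSolenoidalFlow L (σ + 1) T ubar → IsSolenoidalFlow L (σ + 1) T w →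
      IsSolenoidalFlow L σ T v → IsPressure L T q →
      (∀ t ∈ Icc 0 T, modeNorm L (σ + 1) (w t) ≤ Y) →
      (∀ t ∈ Icc 0 T, ∀ x, HasDerivWithinAt (fun τ => v τ x)
        (-(advect (ubar t) (v t) x + (advect (v t) (ubar t) x + advect (w t) (w t) x) +
          gradient (q t) x)) (Icc 0 T) t) →
      ∀ t ∈ Icc 0 T, modeNorm L σ (v t) ^ 2 ≤ modeNorm L σ (v 0) ^ 2 +
        ∫ τ in (0 : ℝ)..t, 2 * C * (modeNorm L (σ + 1) (ubar τ) * modeNorm L σ (v τ) ^ 2 +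
          modeNorm L σ (v τ) * Y ^ 2) := by
  obtain ⟨C₁, hC₁, htrans⟩ := exists_abs_cutoffPairing_transport_le hL hσ
  obtain ⟨C₂, hC₂, hprod⟩ := exists_abs_cutoffPairing_advect_le hL (σ := σ) (by linarith)
  refine ⟨C₁ + C₂, by positivity, fun T Y ubar w v q hT hubar hw hv hq hY hd t ht => ?_⟩
  have hubar' : IsSolenoidalFlow L σ T ubar := hubar.of_le hL (by linarith)
  have hw' : IsSolenoidalFlow L σ T w := hw.of_le hL (by linarith)
  have hn' := hv.isBoundedMeasurable hL hT
  have hb := hubar.isBoundedMeasurable hL hT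
  have hc₁ : ∀ t ∈ Icc 0 T, Continuous (advect (ubar t) (v t)) := fun t ht =>
    continuous_advect (hubar.field ht).contDiff.continuous (hv.field ht).contDiff
  have hc₂ : ∀ t ∈ Icc 0 T, Continuous (advect (v t) (ubar t)) := fun t ht =>
    continuous_advect (hv.field ht).contDiff.continuous (hubar.field ht).contDiff
  have hc₃ : ∀ t ∈ Icc 0 T, Continuous (advect (w t) (w t)) := fun t ht =>
    continuous_advect (hw.field ht).contDiff.continuous (hw.field ht).contDiff
  have hc₂₃ : ∀ t ∈ Icc 0 T, Continuous fun x => advect (v t) (ubar t) x + advect (w t) (w t) x :=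
    fun t ht => (hc₂ t ht).add (hc₃ t ht)
  have hc : ∀ t ∈ Icc 0 T, Continuous fun x => advect (ubar t) (v t) x +
      (advect (v t) (ubar t) x + advect (w t) (w t) x) := fun t ht =>
    (hc₁ t ht).add (hc₂₃ t ht)
  refine sq_modeNorm_le_add_integral hL hv.contDiffOn (fun t ht => (hv.field ht).summable)
    (g := fun t x => -(advect (ubar t) (v t) x +
      (advect (v t) (ubar t) x + advect (w t) (w t) x) + gradient (q t) x))
    (fun t ht => ((hc t ht).add (continuous_gradient (hq t ht).1)).neg) hd
    (((hb.mul hn'.sq).add (hn'.mul (.const T (Y ^ 2)))).const_mul _).integrableOn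
    (fun t ht n S hn hS => ?_) ht
  rw [cutoffPairing_neg_add_gradient hL S (hv.field ht) (hc t ht) (hq t ht).2 (hq t ht).1,
    cutoffPairing_add S _ (hc₁ t ht) (hc₂₃ t ht),
    cutoffPairing_add S _ (hc₂ t ht) (hc₃ t ht)]
  have h1 := htrans n S _ _ hn hS (hv.field ht) (hubar'.field ht)
  have h2 := hprod n S _ _ _ hn (hv.field ht) (hv.field ht) (hubar.field ht)
  have h3 := hprod n S _ _ _ hn (hv.field ht) (hw'.field ht) (hw.field ht)
  have h4 := modeNorm_mono (σ := σ) (by linarith) (hubar.field ht).summable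
  have h5 := modeNorm_mono (σ := σ) (by linarith) (hw.field ht).summable
  have h6 := hY t ht
  set m := modeNorm L σ (v t)
  set b := modeNorm L (σ + 1) (ubar t)
  set y := modeNorm L (σ + 1) (w t)
  have hm0 : 0 ≤ m := modeNorm_nonneg _ _ _
  have hb0 : 0 ≤ b := modeNorm_nonneg _ _ _
  have hy0 : 0 ≤ y := modeNorm_nonneg _ _ _
  have hY0 : 0 ≤ Y := hy0.trans h6
  have h7 : C₁ * (m * modeNorm L σ (ubar t) * m) ≤ C₁ * (m * b * m) := by gcongr
  have h8 : C₂ * (m * modeNorm L σ (w t) * y) ≤ C₂ * (m * Y * Y) := by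
    gcongr
    exact h5.trans h6
  have h9 := neg_le_of_abs_le h1
  have h10 := neg_le_of_abs_le h2
  have h11 := neg_le_of_abs_le h3
  have h12 : 0 ≤ C₁ * (m * Y * Y) := by positivity
  linarith

/-! ### The equations for the differences -/

lemma modeNorm_of_ae_eq_smul {L σ c : ℝ} (hc : 0 ≤ c) {f g : E3 → E3}
    (h : f =ᵐ[volume] fun x => c • g x) : modeNorm L σ f = c * modeNorm L σ g := by
  have h1 : ∀ k, sobolevTerm L σ f k = c ^ 2 * sobolevTerm L σ g k := fun k => by
    rw [sobolevTerm_eq, sobolevTerm_eq, vecCoeff_congr_ae h, vecCoeff_const_smul, norm_smul,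
      Complex.norm_real, Real.norm_of_nonneg hc]
    ring
  rw [modeNorm, tsum_congr h1, tsum_mul_left, Real.sqrt_mul (sq_nonneg c), Real.sqrt_sq hc, modeNorm]

/-- The perturbation `w = u - ū` solves `∂ₜ w + u · ∇w + w · ∇ū + ∇q = 0`. -/
lemma IsEulerSolution.exists_sub_momentum {L σ τ T : ℝ} {u₀ ubar₀ : E3 → E3}
    {u ubar : ℝ → E3 → E3} (hu : IsEulerSolution L σ T u₀ u) {Tbar : ℝ} (hT : T ≤ Tbar)
    (hubar : IsEulerSolution L τ Tbar ubar₀ ubar) :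
    ∃ q : ℝ → E3 → ℝ, IsPressure L T q ∧ ∀ t ∈ Icc 0 T, ∀ x,
      HasDerivWithinAt (fun r => u r x - ubar r x)
        (-(advect (u t) (fun y => u t y - ubar t y) x +
          advect (fun y => u t y - ubar t y) (ubar t) x + gradient (q t) x)) (Icc 0 T) t := by
  obtain ⟨p, hp, hpd⟩ := hu.momentum
  obtain ⟨pbar, hpbar', hpbard⟩ := hubar.momentum
  have hpbar := hpbar'.mono hT
  have hsub : Icc 0 T ⊆ Icc 0 Tbar := Icc_subset_Icc_right hT
  refine ⟨_, hp.sub hpbar, fun t ht x => ?_⟩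
  refine ((hpd t ht x).fun_sub ((hpbard t (hsub ht) x).mono hsub)).congr_deriv ?_
  rw [advect_sub_right ((hu.flow.field ht).contDiff.differentiable one_ne_zero)
    ((hubar.flow.field (hsub ht)).contDiff.differentiable one_ne_zero), advect_sub_left,
    gradient_fun_sub ((hp t ht).1.differentiable one_ne_zero)
      ((hpbar t ht).1.differentiable one_ne_zero)]
  abel

/-- The linearization error `v = w - ũ` solves `∂ₜ v + ū · ∇v + v · ∇ū + w · ∇w + ∇q = 0`. -/
lemma IsLinearizedEulerSolution.exists_sub_momentum {L σ τ T : ℝ} {v₀ : E3 → E3}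
    {u ubar utilde : ℝ → E3 → E3} (hut : IsLinearizedEulerSolution L σ T ubar v₀ utilde)
    (hu : IsSolenoidalFlow L σ T u) (hubar : IsSolenoidalFlow L τ T ubar)
    {p : ℝ → E3 → ℝ} (hp : IsPressure L T p)
    (hd : ∀ t ∈ Icc 0 T, ∀ x, HasDerivWithinAt (fun r => u r x - ubar r x)
        (-(advect (u t) (fun y => u t y - ubar t y) x +
          advect (fun y => u t y - ubar t y) (ubar t) x + gradient (p t) x)) (Icc 0 T) t) :
    ∃ q : ℝ → E3 → ℝ, IsPressure L T q ∧ ∀ t ∈ Icc 0 T, ∀ x,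
      HasDerivWithinAt (fun r => u r x - ubar r x - utilde r x)
        (-(advect (ubar t) (fun y => u t y - ubar t y - utilde t y) x +
          (advect (fun y => u t y - ubar t y - utilde t y) (ubar t) x +
            advect (fun y => u t y - ubar t y) (fun y => u t y - ubar t y) x) +
          gradient (q t) x)) (Icc 0 T) t := by
  obtain ⟨r, hr, hrd⟩ := hut.momentum
  refine ⟨_, hp.sub hr, fun t ht x => ?_⟩
  have du := (hu.field ht).contDiff.differentiable one_ne_zero
  have db := (hubar.field ht).contDiff.differentiable one_ne_zero
  have dt := (hut.flow.field ht).contDiff.differentiable one_ne_zero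
  refine ((hd t ht x).fun_sub (hrd t ht x)).congr_deriv ?_
  rw [advect_sub_right (du.fun_sub db) dt, advect_sub_left (fun y => u t y - ubar t y) (utilde t),
    advect_sub_left (u t) (ubar t) (fun y => u t y - ubar t y),
    gradient_fun_sub ((hp t ht).1.differentiable one_ne_zero)
      ((hr t ht).1.differentiable one_ne_zero)]
  abel

end EulerTorus

end

open EulerTorus
theorem proposition2p1 (L : ℝ) (hL : 0 < L) (s : ℝ) (hs : 5 / 2 < s) :
    ∃ C : ℝ, 0 < C ∧
      ∀ (Tbar : ℝ), 0 < Tbar →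
      ∀ (ubar₀ : E3 → E3) (ubar : ℝ → E3 → E3),
        MemSobolevTorus L (s + 2) ubar₀ →
        IsEulerSolution L (s + 2) Tbar ubar₀ ubar →
      ∀ (utilde₀ : E3 → E3), MemSobolevTorus L (s + 1) utilde₀ →
      ∀ (ε : ℝ), 0 < ε →
        ε * (C * sobolevNorm L (s + 1) utilde₀ * Tbar) ≤
          Real.exp (-(C * ∫ τ in (0 : ℝ)..Tbar, sobolevNorm L (s + 2) (ubar τ))) →
      ∀ (T : ℝ), 0 < T → T ≤ Tbar →
      ∀ (u utildeLin : ℝ → E3 → E3),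
        IsEulerSolution L (s + 1) T (fun x => ubar₀ x + ε • utilde₀ x) u →
        IsLinearizedEulerSolution L (s + 1) T ubar (fun x => ε • utilde₀ x) utildeLin →
      ∀ t ∈ Set.Icc 0 T, ∀ x : E3,
        ‖curl (u t) x - curl (fun y => ubar t y + utildeLin t y) x‖ ≤
          ε ^ 2 * sobolevNorm L (s + 1) utilde₀ ^ 2 * C * Tbar *
            Real.exp (C * ∫ τ in (0 : ℝ)..Tbar, sobolevNorm L (s + 2) (ubar τ)) := by
  obtain ⟨C₁, hC₁, hpert⟩ := exists_perturbation_estimate hL (σ := s + 1) (by linarith)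
  obtain ⟨C₂, hC₂, hlin⟩ := exists_linearization_estimate hL hs
  obtain ⟨K, hK, hcurl⟩ := exists_norm_curl_le hL hs
  set κ := √((2 * L) ^ 3) with hκ
  have hκ0 : 0 < κ := sqrt_side_pos hL
  -- the first part of the constant serves the exponents, the second one the prefactor
  set A := 4 * K * √C₂ * Real.exp (C₂ / 2) with hA
  have hA0 : 0 ≤ A := by positivity
  set C := (2 * C₁ + C₂) / κ + A / κ ^ 2 + 1 with hC
  have hCpos : 0 < C := by positivity
  have hCκ : 2 * C₁ + C₂ ≤ C * κ := by
    have e : C * κ = (2 * C₁ + C₂) + A / κ + κ := by rw [hC]; field_simp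
    have : 0 ≤ A / κ := by positivity
    linarith
  have hCA : A ≤ C * κ ^ 2 := by
    have e : C * κ ^ 2 = (2 * C₁ + C₂) * κ + A + κ ^ 2 := by rw [hC]; field_simp
    have : 0 ≤ (2 * C₁ + C₂) * κ := by positivity
    nlinarith
  refine ⟨C, hCpos, fun Tbar hTbar ubar₀ ubar _ hubar utilde₀ hutilde₀ ε hε hsmall T hT hTT u
    utilde hu hut t ht x => ?_⟩
  have hs2 : s + 1 + 1 = s + 2 := by ring
  simp only [sobolevNorm_eq hL, ← hκ, intervalIntegral.integral_const_mul] at hsmall ⊢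
  set B := ∫ τ in (0 : ℝ)..Tbar, modeNorm L (s + 2) (ubar τ) with hB
  set N := modeNorm L (s + 1) utilde₀ with hN
  have hN0 : 0 ≤ N := modeNorm_nonneg _ _ _
  have hz : (0 : ℝ) ∈ Icc 0 Tbar := left_mem_Icc.2 hTbar.le
  have hbb := hubar.flow.isBoundedMeasurable hL hTbar
  have hB0 : 0 ≤ B :=
    intervalIntegral.integral_nonneg hTbar.le fun _ _ => modeNorm_nonneg _ _ _
  have hBt : ∀ t ∈ Icc 0 T, ∫ τ in (0 : ℝ)..t, modeNorm L (s + 2) (ubar τ) ≤ B := fun t ht =>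
    intervalIntegral.integral_mono_interval le_rfl ht.1 (ht.2.trans hTT)
      (Filter.Eventually.of_forall fun _ => modeNorm_nonneg _ _ _)
      (hbb.intervalIntegrable hz (right_mem_Icc.2 hTbar.le))
  have hubar2 : IsSolenoidalFlow L (s + 2) T ubar := hubar.flow.mono hTT
  have hubar1 : IsSolenoidalFlow L (s + 1) T ubar := hubar2.of_le hL (by linarith)
  have hw := hu.flow.sub hL hubar1
  have hv := hw.sub hL hut.flow
  have hv' : IsSolenoidalFlow L s T _ := hv.of_le hL (by linarith)
  have hw0 : (fun x => u 0 x - ubar 0 x) =ᵐ[volume] fun x => ε • utilde₀ x := by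
    filter_upwards [hu.initial, hubar.initial] with x h1 h2
    rw [h1, h2, add_sub_cancel_left]
  have hv0 : (fun x => u 0 x - ubar 0 x - utilde 0 x) =ᵐ[volume] fun x => (0 : ℝ) • utilde₀ x := by
    filter_upwards [hw0, hut.initial] with x h1 h2
    rw [h1, h2, sub_self, zero_smul]
  obtain ⟨p, hp, hpd⟩ := hu.exists_sub_momentum hTT hubar
  have hE := hpert T u ubar p hT hu.flow (hs2 ▸ hubar2) hp hpd
  rw [hs2, modeNorm_of_ae_eq_smul hε.le hw0] at hE
  have hsm : C₁ * (ε * N * Real.exp (C₁ * B)) * T ≤ 1 / 2 := by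
    have h1 : ε * N * Tbar * (2 * C₁) ≤ ε * N * Tbar * (C * κ) :=
      mul_le_mul_of_nonneg_left (by linarith) (by positivity)
    have h2 : Real.exp (-(C * (κ * B))) ≤ Real.exp (-(C₁ * B)) := by
      rw [← mul_assoc]
      gcongr
      linarith
    have h3 : Real.exp (-(C₁ * B)) * Real.exp (C₁ * B) = 1 := by
      rw [← Real.exp_add]; simp
    have h4 : ε * N * Tbar * (2 * C₁) ≤ Real.exp (-(C₁ * B)) := by linarith
    have h5 := mul_le_mul_of_nonneg_right h4 (Real.exp_pos (C₁ * B)).le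
    have h6 : C₁ * (ε * N * Real.exp (C₁ * B)) * T ≤ C₁ * (ε * N * Real.exp (C₁ * B)) * Tbar := by
      gcongr
    linarith
  have hY := fun t (ht : t ∈ Icc 0 T) => le_of_sq_le_add_integral hC₁ (mul_nonneg hε.le hN0)
    (hw.isBoundedMeasurable hL hT) (hbb.mono hTT) (fun _ _ => modeNorm_nonneg _ _ _)
    (fun _ _ => modeNorm_nonneg _ _ _) hBt hE hsm ht
  obtain ⟨q, hq, hqd⟩ := hut.exists_sub_momentum hu.flow hubar1 hp hpd
  have hF := hlin T _ ubar _ _ q hT hubar1 hw hv' hq hY hqd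
  rw [modeNorm_of_ae_eq_smul le_rfl hv0] at hF
  have hBt1 : ∀ t ∈ Icc 0 T, ∫ τ in (0 : ℝ)..t, modeNorm L (s + 1) (ubar τ) ≤ B := by
    intro t ht
    have h0 : (0 : ℝ) ∈ Icc 0 T := left_mem_Icc.2 hT.le
    refine le_trans (intervalIntegral.integral_mono_on ht.1
      ((hubar1.isBoundedMeasurable hL hT).intervalIntegrable h0 ht)
      ((hbb.mono hTT).intervalIntegrable h0 ht) fun τ hτ => ?_) (hBt t ht)
    exact modeNorm_mono (by linarith) (hubar2.field ⟨hτ.1, hτ.2.trans ht.2⟩).summable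
  have hfinal := le_of_sq_le_integral hC₂ (sq_nonneg (2 * (ε * N * Real.exp (C₁ * B)))) hTbar hTT
    (hv'.isBoundedMeasurable hL hT) (hubar1.isBoundedMeasurable hL hT)
    (fun _ _ => modeNorm_nonneg _ _ _) hBt1 (fun t ht => by simpa using hF t ht) ht
  have hdu := (hu.flow.field ht).contDiff.differentiable one_ne_zero
  have hdb := (hubar1.field ht).contDiff.differentiable one_ne_zero
  have hdt := (hut.flow.field ht).contDiff.differentiable one_ne_zero
  rw [← curl_sub hdu (hdb.fun_add hdt)]
  simp only [← sub_sub]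
  refine (hcurl _ (hv'.field ht) x).trans ((mul_le_mul_of_nonneg_left hfinal hK).trans ?_)
  have hexp : Real.exp (C₁ * B) ^ 2 * Real.exp (C₂ * B) ≤ Real.exp (C * (κ * B)) := by
    rw [← Real.exp_nat_mul, ← Real.exp_add]
    gcongr
    push_cast
    calc 2 * (C₁ * B) + C₂ * B = (2 * C₁ + C₂) * B := by ring
      _ ≤ C * κ * B := by gcongr
      _ = C * (κ * B) := by ring
  calc K * (√C₂ * Real.exp (C₂ / 2) * (2 * (ε * N * Real.exp (C₁ * B))) ^ 2 * Tbar *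
        Real.exp (C₂ * B)) =
        A * (ε * N) ^ 2 * Tbar * (Real.exp (C₁ * B) ^ 2 * Real.exp (C₂ * B)) := by rw [hA]; ring
    _ ≤ C * κ ^ 2 * (ε * N) ^ 2 * Tbar * Real.exp (C * (κ * B)) := by gcongr
    _ = _ := by ring
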